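/- Conventions. A marked rational plane tropical curve $C=(\Gamma,x_1,\dots,x_n,h)$ is a metric tree $\Gamma$ with vertices of valence $\ge 3$, with unbounded ends, $n$ of which are the markings $x_i$, and a map $h:\Gamma\to\mathbb{R}^2$ that is affine with integral direction vector on every edge, balanced at every vertex, and contracts the markings. It has degree $d$ if the directions of its non-marked ends are $(-1,0),(0,-1),(1,1)$, each $d$ times. Let $\mathcal{M}_{d,n}$ be the space of these curves, $ev_i(C)=h(x_i)$, and let $\delta$ be the forgetful map to the space $\mathcal{M}_4$ of $4$-marked abstract tropical curves given by $x_1,\dots,x_4$. An element of $\mathcal{M}_4$ is of type (A), (B), (C) if it has one bounded edge (of some length $>0$) separating the markings as $12|34$, $13|24$, $14|23$ respectively, and of type (D) if it has no bounded edge. Let $d\ge 2$, $n=3d$, and let $\mathcal{L}^l$ be a plane tropical curve of degree $l$. Let $$\tilde\pi=ev_3\times\cdots\times ev_n\times\delta:\ \{C\in\mathcal{M}_{d,n}:\ h(x_1),h(x_2)\in\mathcal{L}^l,\ h(x_1)\ne h(x_2)\}\longrightarrow \mathbb{R}^{2n-4}\times\mathcal{M}_4 .$$ A point $\mathcal{Q}$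 of the target is in $\tilde\pi$-general position if its $\mathcal{M}_4$-coordinate is not of type (D) and every $C\in\tilde\pi^{-1}(\mathcal{Q})$ is generic, i.e. $3$-valent with $h(x_1),h(x_2)$ in relative interiors of edges of $\mathcal{L}^l$. Multiplicities are absolute values of determinants of the linear maps in the coordinates given by the image of a root vertex and the lengths of the bounded edges; for $mult_C(\tilde\pi)$, the two conditions $h(x_i)\in\mathcal{L}^l$ ($i=1,2$) enter as two rows $\det(u_i,h(x_i))$, where $u_i$ is the direction vector, weight included, of the edge of $\mathcal{L}^l$ through $h(x_i)$, and the $\mathcal{M}_4$-row is the length coordinate. **Proposition.** Let $\mathcal{Q}=(q_3,\dots,q_n,z)$ be in $\tilde\pi$-general position with $z$ of type (B) and of any length (in particular, of large length). Let $C\in\tilde\pi^{-1}(\mathcal{Q})$ have a contracted bounded edge $E$ such that cutting $C$ at $E$ (which becomes an additional marking $P$ on one part and $Q$ on the other) gives curves $C_1,C_2$ of degrees $d_1,d_2>0$ with $d_1+d_2=d$, with $x_1,x_3$ on $C_1$, with $x_2,x_4$ on $C_2$, and with exactly $3d_1-2$ of $x_5,\dots,x_n$ on $C_1$. Then $$mult_C(\tilde\pi)=mult_{C_1}(ev)\cdot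 mult_{C_2}(ev)\cdot (C_1\cdot C_2)_{P=Q}\cdot (C_1\cdot\mathcal{L}^l)_{x_1}\cdot (C_2\cdot\mathcal{L}^l)_{x_2}.$$ Here $mult_{C_i}(ev)$ is the multiplicity of the product of the evaluations at the $3d_i-1$ markings among $x_3,\dots,x_n$ that lie on $C_i$, taken at the curve obtained from $C_i$ by forgetting its other two markings ($x_i$, and $P$ or $Q$). The intersection multiplicities $(C_1\cdot C_2)_{P=Q}$ and $(C_i\cdot\mathcal{L}^l)_{x_i}$ are the absolute values of the determinants of the direction vectors, weights included, of the two edges meeting there. -/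

import Mathlib

namespace TropicalTangency

noncomputable section

open scoped Classical

/-! ### Plane vectors and determinants -/

/-- The determinant of two plane vectors. -/
def cross {R : Type} [CommRing R] (u v : Fin 2 → R) : R := u 0 * v 1 - u 1 * v 0

/-- The absolute value of the determinant of an integer matrix whose rows and columns are indexed
by two (possibly different) finite sets of the same size. Up to sign the determinant does not depend
on the bijection used to identify the two index sets. (It is `0` if the matrix is not square.) -/
def absDet {m n : Type} [Fintype m] [Fintype n] (M : Matrix m n ℤ) : ℕ :=
  if h : Nonempty (m ≃ n) then (M.submatrix id h.some).det.natAbs else 0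

/-! ### Graphs with unbounded ends, markings and a map to the plane -/

/-- The combinatorial data of a marked graph mapped to the plane.
`V` is the set of vertices, `graph` records the bounded edges, `len a b` is the length of the bounded
edge `ab`, `dir a b` the direction vector of the flag `(a, ab)` (pointing from `a` to `b`) and `pos`
the images of the vertices. `ends` is the set of non-marked unbounded edges, attached at
`endAt` and with direction `endDir`. The marked unbounded edges are indexed by `ι`; they are attached
at the vertices `mark i` and contracted by the map to the plane, so their direction is `0`. -/
structure MarkedGraph (ι : Type) where
  V : Type
  [fintypeV : Fintype V]
  graph : SimpleGraph V
  len : V → V → ℝ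
  dir : V → V → Fin 2 → ℤ
  pos : V → Fin 2 → ℝ
  ends : Type
  [fintypeEnds : Fintype ends]
  endAt : ends → V
  endDir : ends → Fin 2 → ℤ
  mark : ι → V

attribute [instance] MarkedGraph.fintypeV MarkedGraph.fintypeEnds

namespace MarkedGraph

variable {ι : Type}

/-- The valence of a vertex: the number of its flags (bounded edges, unbounded edges, markings). -/
def valence (C : MarkedGraph ι) (v : C.V) : ℕ :=
  Nat.card {w : C.V // C.graph.Adj v w} + Nat.card {e : C.ends // C.endAt e = v}
    + Nat.card {i : ι // C.mark i = v}

/-- `C` is a (rational) marked plane tropical curve: the graph is a tree all of whose vertices have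
valence at least `3`, bounded edges have positive lengths, the map to the plane is affine
on each edge with integral direction vector, and every vertex is balanced. -/
structure IsPlaneTropicalCurve (C : MarkedGraph ι) : Prop where
  isTree : C.graph.IsTree
  three_le_valence : ∀ v, 3 ≤ C.valence v
  len_pos : ∀ a b, C.graph.Adj a b → 0 < C.len a b
  len_symm : ∀ a b, C.graph.Adj a b → C.len b a = C.len a b
  dir_symm : ∀ a b, C.graph.Adj a b → C.dir b a = - C.dir a b
  pos_eq : ∀ a b, C.graph.Adj a b → ∀ k, C.pos b k = C.pos a k + C.len a b * (C.dir a b k : ℝ)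
  balanced : ∀ v, (∑ w with C.graph.Adj v w, C.dir v w) + (∑ e with C.endAt e = v, C.endDir e) = 0

/-- `C` has degree `d`: the multiset of directions of its non-marked unbounded edges consists
of `(-1,0)`, `(0,-1)` and `(1,1)`, each of them `d` times. -/
def HasDegree (C : MarkedGraph ι) (d : ℕ) : Prop :=
  (Finset.univ : Finset C.ends).val.map C.endDir
    = d • ({![-1, 0], ![0, -1], ![1, 1]} : Multiset (Fin 2 → ℤ))

/-- The image point `h(x_i)` of the marking `i`. -/
def ev (C : MarkedGraph ι) (i : ι) : Fin 2 → ℝ := C.pos (C.mark i)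

/-- `v` lies on the side of `a` when the edge `ab` is removed. -/
def OnSide (C : MarkedGraph ι) (a b v : C.V) : Prop :=
  (C.graph.deleteEdges {s(a, b)}).Reachable a v

/-! ### Forgetting a marking -/

/-- Remove the marking `x` (without straightening). -/
def drop (C : MarkedGraph ι) (x : ι) : MarkedGraph {i : ι // i ≠ x} where
  V := C.V
  graph := C.graph
  len := C.len
  dir := C.dir
  pos := C.pos
  ends := C.ends
  endAt := C.endAt
  endDir := C.endDir
  mark i := C.mark i

/-- Straighten a vertex `v` of valence `2` with a neighbour `w`: if both edges at `v` are bounded,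
they are merged to a single bounded edge; otherwise, `v` lies on the bounded edge `vw` and on an
unbounded edge, which are merged to an unbounded edge attached at `w`. -/
def straighten (C : MarkedGraph ι) (v w : C.V) (hvw : C.graph.Adj v w) : MarkedGraph ι where
  V := {u : C.V // u ≠ v}
  graph := SimpleGraph.fromRel fun s t : {u : C.V // u ≠ v} =>
    C.graph.Adj s t ∨ (C.graph.Adj s v ∧ C.graph.Adj v t)
  len s t := if C.graph.Adj s t then C.len s t else C.len s v + C.len v t
  dir s t := if C.graph.Adj s t then C.dir s t else C.dir s v
  pos s := C.pos s
  ends := C.ends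
  endAt e := if h : C.endAt e = v then ⟨w, hvw.ne'⟩ else ⟨C.endAt e, h⟩
  endDir := C.endDir
  mark i := if h : C.mark i = v then ⟨w, hvw.ne'⟩ else ⟨C.mark i, h⟩

/-- The forgetful map: remove the marking `x` and, if its vertex has become
`2`-valent, straighten that vertex. -/
def forget (C : MarkedGraph ι) (x : ι) : MarkedGraph {i : ι // i ≠ x} :=
  if h : (C.drop x).valence (C.mark x) = 2 ∧ ∃ w, (C.drop x).graph.Adj (C.mark x) w then
    (C.drop x).straighten (C.mark x) h.2.choose h.2.choose_spec
  else C.drop x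

/-! ### Splitting at a bounded edge -/

/-- The part of `C` on the side of `a` after cutting the bounded edge `ab`. The cut edge becomes
the additional marking `none`, attached at `a`. -/
def side (C : MarkedGraph ι) (a b : C.V) :
    MarkedGraph (Option {i : ι // C.OnSide a b (C.mark i)}) where
  V := {v : C.V // C.OnSide a b v}
  graph := C.graph.induce {v : C.V | C.OnSide a b v}
  len s t := C.len s t
  dir s t := C.dir s t
  pos s := C.pos s
  ends := {e : C.ends // C.OnSide a b (C.endAt e)}
  endAt e := ⟨C.endAt e, e.2⟩
  endDir e := C.endDir e
  mark
    | none => ⟨a, SimpleGraph.Reachable.refl a⟩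
    | some i => ⟨C.mark i, i.2⟩

/-! ### Coordinates on the cells of the moduli space and evaluation maps

On the cell of all curves of a given combinatorial type, coordinates are the image of a root vertex
`r` and the lengths of the bounded edges. In these coordinates the image of a vertex `t` is the sum of
`h(r)` and of `len e • dir e` over all bounded edges `e` on the path from `r` to `t`. -/

/-- The coefficient vector of the length of the bounded edge `e` in the image of the vertex `t`: the
direction vector of `e`, pointing from `r` to `t`, if `e` lies on the path from `r` to `t`, and `0`
otherwise. -/
def lengthCoeff (C : MarkedGraph ι) (r t : C.V) (e : C.graph.edgeSet) : Fin 2 → ℤ :=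
  ∑ p : C.V × C.V with s(p.1, p.2) = (e : Sym2 C.V) ∧ C.OnSide p.1 p.2 r ∧ C.OnSide p.2 p.1 t,
    C.dir p.1 p.2

/-- The image of the vertex `t` as a linear function of the coordinates of the cell. -/
def evCoeff (C : MarkedGraph ι) (r t : C.V) : Fin 2 ⊕ C.graph.edgeSet → Fin 2 → ℤ
  | .inl k => Pi.single k 1
  | .inr e => C.lengthCoeff r t e

/-- The matrix of the product of the evaluation maps at all markings, with respect to the root `r`. -/
def evMatrix (C : MarkedGraph ι) (r : C.V) : Matrix (ι × Fin 2) (Fin 2 ⊕ C.graph.edgeSet) ℤ :=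
  fun i c => C.evCoeff r (C.mark i.1) c i.2

/-- The multiplicity at `C` of the product `ev` of the evaluation maps at all markings of `C`. It does
not depend on the root vertex. -/
def evMult [Fintype ι] (C : MarkedGraph ι) : ℕ :=
  if h : Nonempty C.V then absDet (C.evMatrix h.some) else 0

/-! ### Directions and intersection multiplicities -/

/-- `u` is the direction vector of a non-marked flag at the vertex `v`. -/
def IsFlagDir (C : MarkedGraph ι) (v : C.V) (u : Fin 2 → ℤ) : Prop :=
  (∃ w, C.graph.Adj v w ∧ C.dir v w = u) ∨ ∃ e, C.endAt e = v ∧ C.endDir e = u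

/-- The direction vector (weight included, unique up to sign) of the edge on which the marking `x`
lies, if `x` is attached at a `3`-valent vertex: the other two flags at this vertex
have opposite directions. It is `0` if these flags are contracted. -/
def edgeDir (C : MarkedGraph ι) (x : ι) : Fin 2 → ℤ :=
  if h : ∃ u, u ≠ 0 ∧ C.IsFlagDir (C.mark x) u then h.choose else 0

/-- The intersection multiplicity at a common image point of a marking `P` on an edge of `C₁` and a
marking `Q` on an edge of `C₂`: the absolute value of the determinant of the two direction vectors. -/
def interMult {ι₁ ι₂ : Type} (C₁ : MarkedGraph ι₁) (P : ι₁) (C₂ : MarkedGraph ι₂) (Q : ι₂) : ℕ :=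
  (cross (C₁.edgeDir P) (C₂.edgeDir Q)).natAbs

end MarkedGraph

/-! ### Tropical plane curves of degree `l` -/

/-- A tropical plane curve of degree `l` (of any genus), given by a tropical polynomial
`max (coeff (i, j) + i x + j y)`, the maximum being over all `i, j ≥ 0` with `i + j ≤ l`. -/
structure TropicalCurve (l : ℕ) where
  coeff : {m : ℕ × ℕ // m.1 + m.2 ≤ l} → ℝ

namespace TropicalCurve

variable {l : ℕ}

/-- The value of the tropical monomial `m` at `p`. -/
def term (L : TropicalCurve l) (p : Fin 2 → ℝ) (m : {m : ℕ × ℕ // m.1 + m.2 ≤ l}) : ℝ :=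
  L.coeff m + m.1.1 * p 0 + m.1.2 * p 1

/-- `m` is a monomial at which the maximum is attained at `p`. -/
def IsMax (L : TropicalCurve l) (p : Fin 2 → ℝ) (m : {m : ℕ × ℕ // m.1 + m.2 ≤ l}) : Prop :=
  ∀ m', L.term p m' ≤ L.term p m

/-- The point `p` lies on the tropical curve: the maximum is attained at least twice. -/
def Contains (L : TropicalCurve l) (p : Fin 2 → ℝ) : Prop :=
  ∃ m m', m ≠ m' ∧ L.IsMax p m ∧ L.IsMax p m'

/-- `p` lies in the relative interior of an edge of the curve with weighted direction vector `u`
(weight times primitive direction): the monomials maximal at `p` lie on the segment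
between two of them, and `u` is the vector of this (dual) segment rotated by a right angle. -/
def IsEdgeVector (L : TropicalCurve l) (p : Fin 2 → ℝ) (u : Fin 2 → ℤ) : Prop :=
  ∃ m m', m ≠ m' ∧ L.IsMax p m ∧ L.IsMax p m' ∧
    (∀ k, L.IsMax p k → ∃ t : ℝ, 0 ≤ t ∧ t ≤ 1 ∧
      (k.1.1 : ℝ) = (1 - t) * m.1.1 + t * m'.1.1 ∧ (k.1.2 : ℝ) = (1 - t) * m.1.2 + t * m'.1.2) ∧
    u = ![-((m'.1.2 : ℤ) - m.1.2), (m'.1.1 : ℤ) - m.1.1]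

/-- The point `p` lies in the relative interior of an edge of the curve. -/
def OnEdge (L : TropicalCurve l) (p : Fin 2 → ℝ) : Prop := ∃ u, L.IsEdgeVector p u

/-- The weighted direction vector of the edge of `L` containing `p` in its relative interior (unique
up to sign). -/
def edgeVector (L : TropicalCurve l) (p : Fin 2 → ℝ) : Fin 2 → ℤ :=
  if h : L.OnEdge p then h.choose else 0

end TropicalCurve

/-- The intersection multiplicity `(C · L)_x` of a plane tropical curve `C` with the tropical curve `L`
at the image of the marking `x`: the absolute value of the determinant of the weighted
direction vectors of the two edges meeting there. -/
def MarkedGraph.interMultAt {ι : Type} {l : ℕ} (C : MarkedGraph ι) (L : TropicalCurve l) (x : ι) : ℕ :=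
  (cross (L.edgeVector (C.ev x)) (C.edgeDir x)).natAbs

/-! ### The space `M₄` and the forgetful map to it -/

/-- The moduli space of `4`-marked abstract tropical curves: trees with one bounded edge of
given length separating the markings as `12|34`, `13|24` or `14|23` (types (A), (B), (C)), and the
tree with a single vertex (type (D)). -/
inductive M4 : Type
  | typeA (length : ℝ) (pos : 0 < length)
  | typeB (length : ℝ) (pos : 0 < length)
  | typeC (length : ℝ) (pos : 0 < length)
  | typeD

namespace MarkedGraph

variable {ι : Type}

/-- The bounded edge `e` separates the markings `i, j` from the markings `k, m`. -/
def Separates (C : MarkedGraph ι) (e : C.graph.edgeSet) (i j k m : ι) : Prop :=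
  ∃ a b, (e : Sym2 C.V) = s(a, b) ∧ C.OnSide a b (C.mark i) ∧ C.OnSide a b (C.mark j) ∧
    C.OnSide b a (C.mark k) ∧ C.OnSide b a (C.mark m)

/-- The length of a bounded edge. -/
def edgeLen (C : MarkedGraph ι) (e : C.graph.edgeSet) : ℝ :=
  C.len (Quot.out (e : Sym2 C.V)).1 (Quot.out (e : Sym2 C.V)).2

/-- The total length of the bounded edges separating the markings `i, j` from the markings `k, m`. -/
def sepLength (C : MarkedGraph ι) (i j k m : ι) : ℝ :=
  ∑ e with C.Separates e i j k m, C.edgeLen e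

/-- The forgetful map `δ` to `M₄`, for four markings `x 0, x 1, x 2, x 3`: take the minimal
connected subgraph containing these markings and straighten it. If it has a bounded edge, this is
composed of exactly those bounded edges of `C` that separate the four markings into two pairs. -/
def delta (C : MarkedGraph ι) (x : Fin 4 → ι) : M4 :=
  if hA : 0 < C.sepLength (x 0) (x 1) (x 2) (x 3) then .typeA _ hA
  else if hB : 0 < C.sepLength (x 0) (x 2) (x 1) (x 3) then .typeB _ hB
  else if hC : 0 < C.sepLength (x 0) (x 3) (x 1) (x 2) then .typeC _ hC
  else .typeD

end MarkedGraph

/-! ### The map `π̃`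

The markings are indexed by `Fin n`, starting from `0`. -/

/-- The first four of `n ≥ 4` markings. -/
def first4 {n : ℕ} (hn : 4 ≤ n) : Fin 4 → Fin n := Fin.castLE hn

/-- The target `(ℝ²)^(n-2) × M₄` of `π̃`: a point of the plane for every marking except the first two,
and a point of `M₄`. -/
abbrev Target (n : ℕ) : Type := ({i : Fin n // 2 ≤ i.val} → Fin 2 → ℝ) × M4

namespace MarkedGraph

variable {n l : ℕ}

/-- The domain of `π̃`: plane tropical curves of degree `d` with `n` markings, the first two of which
are mapped to two distinct points of `L`. -/
structure InDomain (C : MarkedGraph (Fin n)) (hn : 4 ≤ n) (d : ℕ) (L : TropicalCurve l) : Prop where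
  isCurve : C.IsPlaneTropicalCurve
  hasDegree : C.HasDegree d
  mem_first : L.Contains (C.ev (first4 hn 0))
  mem_second : L.Contains (C.ev (first4 hn 1))
  ev_ne : C.ev (first4 hn 0) ≠ C.ev (first4 hn 1)

/-- The map `π̃ = ev₃ × ⋯ × evₙ × δ`. -/
def piTilde (C : MarkedGraph (Fin n)) (hn : 4 ≤ n) : Target n :=
  (fun i => C.ev i, C.delta (first4 hn))

/-- `C` is a generic point of the domain of `π̃`, i.e. it lies in the interior of a maximal cell: all
vertices are `3`-valent and the first two markings are mapped to the relative interiors of edges of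
`L`. -/
def IsGeneric (C : MarkedGraph (Fin n)) (hn : 4 ≤ n) (L : TropicalCurve l) : Prop :=
  (∀ v, C.valence v = 3) ∧ L.OnEdge (C.ev (first4 hn 0)) ∧ L.OnEdge (C.ev (first4 hn 1))

/-- The matrix of `π̃` at a generic point `C`, in the coordinates of the cell of `C`. The condition that
the first two markings lie on `L` is recorded by one row each, the local equation
`cross u (·) = const` of `L` at the image point, where `u` is the weighted direction vector of the
edge of `L`. There are two rows for each of the other markings. The last row
is the length coordinate of `M₄`. -/
def piMatrix (C : MarkedGraph (Fin n)) (hn : 4 ≤ n) (L : TropicalCurve l) (r : C.V) :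
    Matrix (Fin 2 ⊕ ({i : Fin n // 2 ≤ i.val} × Fin 2) ⊕ Unit) (Fin 2 ⊕ C.graph.edgeSet) ℤ
  | .inl k, c =>
      let x : Fin n := first4 hn (Fin.castLE (by norm_num) k)
      cross (L.edgeVector (C.ev x)) (C.evCoeff r (C.mark x) c)
  | .inr (.inl i), c => C.evCoeff r (C.mark i.1) c i.2
  | .inr (.inr _), .inl _ => 0
  | .inr (.inr _), .inr e =>
      let x := first4 hn
      if C.Separates e (x 0) (x 1) (x 2) (x 3) ∨ C.Separates e (x 0) (x 2) (x 1) (x 3) ∨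
        C.Separates e (x 0) (x 3) (x 1) (x 2) then 1 else 0

/-- The multiplicity of `π̃` at `C`. It does not depend on the root vertex. -/
def piMult (C : MarkedGraph (Fin n)) (hn : 4 ≤ n) (L : TropicalCurve l) : ℕ :=
  if h : Nonempty C.V then absDet (C.piMatrix hn L h.some) else 0

/-- The contracted bounded edge `E = ab` splits `C` into a curve `C₁` of degree `d₁`
(the side of `a`) and a curve `C₂` of degree `d₂` (the side of `b`), such that the markings
`x₁, x₃` are on `C₁`, the markings `x₂, x₄` are on `C₂`, and exactly `3 d₁ - 2` of the
other markings are on `C₁` (hence `3 d₂ - 2` on `C₂`, as `n = 3 (d₁ + d₂)` is the number of markings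
in the case of interest). -/
structure SplitsAt (C : MarkedGraph (Fin n)) (hn : 4 ≤ n) (a b : C.V) (d₁ d₂ : ℕ) : Prop where
  adj : C.graph.Adj a b
  contracted : C.dir a b = 0
  degree_left : (C.side a b).HasDegree d₁
  degree_right : (C.side b a).HasDegree d₂
  left_pos : 0 < d₁
  right_pos : 0 < d₂
  x1 : C.OnSide a b (C.mark (first4 hn 0))
  x3 : C.OnSide a b (C.mark (first4 hn 2))
  x2 : C.OnSide b a (C.mark (first4 hn 1))
  x4 : C.OnSide b a (C.mark (first4 hn 3))
  others : Nat.card {i : Fin n // 4 ≤ i.val ∧ C.OnSide a b (C.mark i)} = 3 * d₁ - 2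

/-- For a curve on one side of a split edge: the multiplicity of the product of evaluations at its
markings except the marking `x` and the new marking `none`, i.e. of `ev` at the curve obtained by
forgetting these two markings. -/
def sideEvMult (C : MarkedGraph (Fin n)) (a b : C.V) (x : Fin n) (hx : C.OnSide a b (C.mark x)) : ℕ :=
  (((C.side a b).forget none).forget ⟨some ⟨x, hx⟩, Option.some_ne_none _⟩).evMult

end MarkedGraph

/-- `Q` is in `π̃`-general position: it lies in the interior of a maximal cell of the target, and all its
inverse images under `π̃` are generic points of the domain. -/
def InGeneralPosition {n l : ℕ} (hn : 4 ≤ n) (d : ℕ) (L : TropicalCurve l) (Q : Target n) : Prop :=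
  Q.2 ≠ M4.typeD ∧
    ∀ C : MarkedGraph (Fin n), C.InDomain hn d L → C.piTilde hn = Q → C.IsGeneric hn L

end

end TropicalTangency

open TropicalTangency

namespace TropicalTangency

noncomputable section

open scoped Classical

/-! ### Absolute determinants of families of linear forms -/

/-! Every multiplicity here is the absolute determinant of a family of linear forms on a lattice:
the integral deformations of a tree, i.e. integral vertex positions and edge lengths compatible with
the edge directions. The root position and the edge lengths are only one basis of this lattice, so
the trees can be cut and straightened without following a root or individual matrix columns.

Geometrically, `C` is two curves `C₁`, `C₂` glued at a common image point by a contracted edge `E`.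
Moving `E`'s length alone moves no point of the plane and changes the `M₄`-coordinate with
coefficient 1, because `E` separates 13|24; so this row and column split off. What remains is a pair
of deformations of `C₁` and `C₂` subject to the two equations `h(P) = h(Q)`. Instead of restricting
to the sublattice where these hold, a translation vector of the second part is added as two new
coordinates: `cutEquiv` identifies `ℤ² × Def(C)` with `Def(C₁) × Def(C₂) × ℤ`, and the translation
coordinates become the gluing forms `h(Q) - h(P)` (`absDetOn_piForm`).

Forgetting a marking of a trivalent tree splits off one coordinate, the movement of the marking
along its edge (`exists_forget_equiv`). Doing so for `P` and `x₁` on `C₁`, and for `Q` and `x₂` on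
`C₂`, makes the remaining family block triangular. The evaluations at the other markings give the
two `ev` blocks, which are square by an Euler characteristic count (`card_sideMarkings`); the two
conditions on `L` give the pivots `cross` of edge directions at `x₁` and `x₂`; the two gluing forms
give the 2×2 determinant of the directions at `P` and `Q` (`absDetOn_glue`, `absDetOn_cutForm`). -/

theorem absDet_eq_natAbs_det {m n : Type} [Fintype m] [Fintype n] (M : Matrix m n ℤ) (e : m ≃ n) :
    absDet M = (M.submatrix id e).det.natAbs := by
  have h : Nonempty (m ≃ n) := ⟨e⟩
  rw [absDet, dif_pos h]
  have : M.submatrix id e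
      = (M.submatrix id h.some).submatrix id (e.trans h.some.symm) := by
    ext i j
    simp
  rw [this, Matrix.det_permute', Int.natAbs_mul]
  simp

theorem absDet_eq_zero {m n : Type} [Fintype m] [Fintype n] (M : Matrix m n ℤ)
    (h : ¬ Nonempty (m ≃ n)) : absDet M = 0 := by
  rw [absDet, dif_neg h]

/-- A change of ℤ-basis has determinant ±1. The two index types may differ, since the cells before
and after straightening or cutting have different edge sets. -/
theorem absDet_basis_eq {m n n' W : Type} [Fintype m] [Fintype n] [Fintype n'] [AddCommGroup W]
    [Module ℤ W] (f : m → W →ₗ[ℤ] ℤ) (b : Module.Basis n ℤ W) (b' : Module.Basis n' ℤ W) :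
    absDet (Matrix.of fun i j => f i (b j)) = absDet (Matrix.of fun i j => f i (b' j)) := by
  have σ : n ≃ n' := b.indexEquiv b'
  by_cases h : Nonempty (m ≃ n)
  · obtain ⟨e⟩ := h
    rw [absDet_eq_natAbs_det _ e, absDet_eq_natAbs_det _ (e.trans σ)]
    have hM : (Matrix.of fun i j => f i (b' j)).submatrix id (e.trans σ)
        = (Matrix.of fun i j => f i (b j)).submatrix id e *
          (b.toMatrix b').submatrix e (e.trans σ) := by
      ext i j
      simp only [Matrix.submatrix_apply, Matrix.of_apply, Matrix.mul_apply, id,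
        Module.Basis.toMatrix_apply]
      conv_lhs => rw [← b.sum_repr (b' ((e.trans σ) j)), map_sum]
      rw [← Equiv.sum_comp e]
      refine Finset.sum_congr rfl fun k _ => ?_
      rw [(f i).map_smul, smul_eq_mul, mul_comm]
    have hu : IsUnit ((b.toMatrix b').submatrix e (e.trans σ)).det := by
      have h1 : (b.toMatrix b').submatrix e (e.trans σ)
          = ((b.reindex e.symm).toMatrix (b'.reindex (e.trans σ).symm)) := by
        ext i j
        simp [Module.Basis.toMatrix_apply]
      rw [h1]
      have := (b.reindex e.symm).invertibleToMatrix (b'.reindex (e.trans σ).symm)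
      exact Matrix.isUnit_det_of_invertible _
    have h2 := congrArg (fun M => (Matrix.det M).natAbs) hM
    simp only [Matrix.det_mul, Int.natAbs_mul, Int.isUnit_iff_natAbs_eq.mp hu, mul_one] at h2
    exact h2.symm
  · rw [absDet_eq_zero _ h, absDet_eq_zero]
    rintro ⟨e⟩
    exact h ⟨e.trans σ.symm⟩

/-! ### Basis-free absolute determinants on lattices, and their block decomposition -/

section AbsDetOn

variable {m m' k W W' A K : Type} [Fintype m] [Fintype m'] [Fintype k]
  [AddCommGroup W] [Module.Free ℤ W] [Module.Finite ℤ W]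
  [AddCommGroup W'] [Module.Free ℤ W'] [Module.Finite ℤ W']
  [AddCommGroup A] [Module.Free ℤ A] [Module.Finite ℤ A]
  [AddCommGroup K] [Module.Free ℤ K] [Module.Finite ℤ K]

/-- The absolute value of the determinant of a family of linear forms on a free abelian group. -/
def absDetOn (f : m → W →ₗ[ℤ] ℤ) : ℕ :=
  absDet (Matrix.of fun i j => f i (Module.Free.chooseBasis ℤ W j))

theorem absDetOn_eq_basis {n : Type} [Fintype n] (f : m → W →ₗ[ℤ] ℤ) (b : Module.Basis n ℤ W) :
    absDetOn f = absDet (Matrix.of fun i j => f i (b j)) :=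
  absDet_basis_eq f _ b

theorem absDetOn_comp_equiv (f : m → W' →ₗ[ℤ] ℤ) (e : W ≃ₗ[ℤ] W') :
    absDetOn (fun i => (f i).comp e.toLinearMap) = absDetOn f := by
  rw [absDetOn_eq_basis f ((Module.Free.chooseBasis ℤ W).map e)]
  simp [absDetOn]

theorem absDetOn_congr_equiv (f : m → W →ₗ[ℤ] ℤ) (g : m → W' →ₗ[ℤ] ℤ) (e : W ≃ₗ[ℤ] W')
    (h : ∀ i w, f i w = g i (e w)) : absDetOn f = absDetOn g := by
  rw [← absDetOn_comp_equiv g e]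
  congr 1
  ext i w
  exact h i w

theorem absDetOn_reindex (f : m → W →ₗ[ℤ] ℤ) (σ : m' ≃ m) :
    absDetOn (fun i => f (σ i)) = absDetOn f := by
  unfold absDetOn
  set b := Module.Free.chooseBasis ℤ W
  by_cases h : Nonempty (m ≃ Module.Free.ChooseBasisIndex ℤ W)
  · obtain ⟨e⟩ := h
    rw [absDet_eq_natAbs_det _ e, absDet_eq_natAbs_det _ (σ.trans e)]
    congr 1
    exact Matrix.det_submatrix_equiv_self σ
      ((Matrix.of fun i j => f i (b j)).submatrix id e)
  · rw [absDet_eq_zero _ h, absDet_eq_zero]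
    rintro ⟨e⟩
    exact h ⟨σ.symm.trans e⟩

/-- Block triangular families of linear forms. -/
theorem absDetOn_prod (f : m → A →ₗ[ℤ] ℤ) (g : k → A × K →ₗ[ℤ] ℤ)
    (hA : Fintype.card m = Module.finrank ℤ A) :
    absDetOn (Sum.elim (fun i => (f i).comp (LinearMap.fst ℤ A K)) g)
      = absDetOn f * absDetOn (fun j => (g j).comp (LinearMap.inr ℤ A K)) := by
  set b := Module.Free.chooseBasis ℤ A
  set b' := Module.Free.chooseBasis ℤ K
  rw [absDetOn_eq_basis _ (b.prod b'), absDetOn_eq_basis _ b, absDetOn_eq_basis _ b']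
  have e₁ : m ≃ Module.Free.ChooseBasisIndex ℤ A := Fintype.equivOfCardEq (by
    rw [hA, Module.finrank_eq_card_chooseBasisIndex])
  by_cases h : Nonempty (k ≃ Module.Free.ChooseBasisIndex ℤ K)
  · obtain ⟨e₂⟩ := h
    rw [absDet_eq_natAbs_det _ (e₁.sumCongr e₂), absDet_eq_natAbs_det _ e₁,
      absDet_eq_natAbs_det _ e₂, ← Int.natAbs_mul, ← Matrix.det_fromBlocks_zero₁₂ _
        (Matrix.of fun i j => g i (b (e₁ j), 0))]
    congr 2
    ext i j
    rcases i with i | i <;> rcases j with j | j <;> simp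
  -- The first block is square by `hA`, so the whole family is square exactly when the second block
  -- is; otherwise both sides are 0 by the convention of `absDet`.
  · rw [absDet_eq_zero (Matrix.of fun i j => _) h, mul_zero, absDet_eq_zero]
    rintro ⟨e⟩
    refine h ⟨Fintype.equivOfCardEq ?_⟩
    have h1 := Fintype.card_congr e
    have h2 := Fintype.card_congr e₁
    simp only [Fintype.card_sum] at h1
    omega

theorem absDetOn_unit (g : Unit → ℤ →ₗ[ℤ] ℤ) : absDetOn g = (g () 1).natAbs := by
  rw [absDetOn_eq_basis g (Module.Basis.singleton Unit ℤ),
    absDet_eq_natAbs_det _ (Equiv.refl _)]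
  convert congrArg Int.natAbs (Matrix.det_unique (n := Unit) _)
  simp

theorem det_fin_two_of_decidableEq (M : Matrix (Fin 2) (Fin 2) ℤ) (inst : DecidableEq (Fin 2)) :
    @Matrix.det _ inst _ _ _ M = M 0 0 * M 1 1 - M 0 1 * M 1 0 := by
  rw [Subsingleton.elim inst (instDecidableEqFin 2), Matrix.det_fin_two]

theorem absDetOn_fin_two_prod (g : Fin 2 → ℤ × ℤ →ₗ[ℤ] ℤ) :
    absDetOn g = (cross (fun k => g k (1, 0)) (fun k => g k (0, 1))).natAbs := by
  rw [absDetOn_eq_basis g (Module.Basis.finTwoProd ℤ),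
    absDet_eq_natAbs_det _ (Equiv.refl _)]
  rw [det_fin_two_of_decidableEq]
  simp [cross, mul_comm]

theorem absDetOn_proj : absDetOn (fun k : Fin 2 => (LinearMap.proj k : (Fin 2 → ℤ) →ₗ[ℤ] ℤ)) = 1 := by
  rw [absDetOn_eq_basis _ (Pi.basisFun ℤ (Fin 2)), absDet_eq_natAbs_det _ (Equiv.refl _)]
  rw [det_fin_two_of_decidableEq]
  simp [Pi.single_apply]

/-- The determinant of the evaluation forms on a product of two groups `W × W'`, each of which is split
as `(A × ℤ) × ℤ`, with one form on either side involving the first copy of `ℤ`, and two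
forms comparing both sides that involve the second copies. -/
theorem absDetOn_glue {A' : Type} [AddCommGroup A'] [Module.Free ℤ A'] [Module.Finite ℤ A']
    (e : W ≃ₗ[ℤ] (A × ℤ) × ℤ) (e' : W' ≃ₗ[ℤ] (A' × ℤ) × ℤ)
    (f : m → A →ₗ[ℤ] ℤ) (f' : m' → A' →ₗ[ℤ] ℤ)
    (hA : Fintype.card m = Module.finrank ℤ A) (hA' : Fintype.card m' = Module.finrank ℤ A')
    (α : A →ₗ[ℤ] ℤ) (α' : A' →ₗ[ℤ] ℤ) (c c' : ℤ)
    (β : Fin 2 → A × ℤ →ₗ[ℤ] ℤ) (β' : Fin 2 → A' × ℤ →ₗ[ℤ] ℤ) (u u' : Fin 2 → ℤ)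
    (g : ((m ⊕ m') ⊕ (Unit ⊕ Unit)) ⊕ Fin 2 → W × W' →ₗ[ℤ] ℤ)
    (hm : ∀ i w, g (.inl (.inl (.inl i))) w = f i (e w.1).1.1)
    (hm' : ∀ i w, g (.inl (.inl (.inr i))) w = f' i (e' w.2).1.1)
    (hα : ∀ w, g (.inl (.inr (.inl ()))) w = α (e w.1).1.1 + (e w.1).1.2 * c)
    (hα' : ∀ w, g (.inl (.inr (.inr ()))) w = α' (e' w.2).1.1 + (e' w.2).1.2 * c')
    (hβ : ∀ k w, g (.inr k) w =
      (β' k (e' w.2).1 + (e' w.2).2 * u' k) - (β k (e w.1).1 + (e w.1).2 * u k)) :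
    absDetOn g = absDetOn f * absDetOn f' * (cross u u').natAbs * c.natAbs * c'.natAbs := by
  -- This order of the coordinates makes the family block triangular: `f`, `f'`, then the two pivots
  -- `c`, `c'`, then the 2×2 block of `u`, `u'`.
  let E : (W × W') ≃ₗ[ℤ] ((A × A') × (ℤ × ℤ)) × (ℤ × ℤ) :=
    { toFun := fun w => (((( e w.1).1.1, (e' w.2).1.1), ((e w.1).1.2, (e' w.2).1.2)),
        ((e w.1).2, (e' w.2).2))
      map_add' := by intro x y; simp
      map_smul' := by intro r x; simp
      invFun := fun z => (e.symm ((z.1.1.1, z.1.2.1), z.2.1), e'.symm ((z.1.1.2, z.1.2.2), z.2.2))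
      left_inv := by intro x; simp
      right_inv := by intro x; simp }
  have h1 := absDetOn_prod (K := A') f
    (fun i : m' => (f' i).comp (LinearMap.snd ℤ A A')) hA
  let G : Unit ⊕ Unit → (A × A') × (ℤ × ℤ) →ₗ[ℤ] ℤ := Sum.elim
      (fun _ => α.comp (LinearMap.fst ℤ A A' ∘ₗ LinearMap.fst ℤ (A × A') (ℤ × ℤ))
        + c • (LinearMap.fst ℤ ℤ ℤ ∘ₗ LinearMap.snd ℤ (A × A') (ℤ × ℤ)))
      (fun _ => α'.comp (LinearMap.snd ℤ A A' ∘ₗ LinearMap.fst ℤ (A × A') (ℤ × ℤ))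
        + c' • (LinearMap.snd ℤ ℤ ℤ ∘ₗ LinearMap.snd ℤ (A × A') (ℤ × ℤ)))
  let F : m ⊕ m' → A × A' →ₗ[ℤ] ℤ := Sum.elim (fun i => (f i).comp (LinearMap.fst ℤ A A'))
      (fun i : m' => (f' i).comp (LinearMap.snd ℤ A A'))
  have h2 := absDetOn_prod F G (by simp [hA, hA'])
  have h3 := absDetOn_prod (Sum.elim (fun i => (F i).comp (LinearMap.fst ℤ (A × A') (ℤ × ℤ))) G)
    (fun i : Fin 2 => (g (.inr i)).comp E.symm.toLinearMap)
    (show Fintype.card ((m ⊕ m') ⊕ (Unit ⊕ Unit)) = _ by simp [hA, hA'])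
  rw [h2, h1] at h3
  have h4 := absDetOn_prod (K := ℤ) (A := ℤ) (k := Unit)
    (fun _ : Unit => c • LinearMap.id) (fun _ => c' • LinearMap.snd ℤ ℤ ℤ) (by simp)
  rw [absDetOn_congr_equiv g _ E, h3]
  · have h5 : absDetOn (fun j : Fin 2 => ((g (.inr j)).comp E.symm.toLinearMap).comp
        (LinearMap.inr ℤ ((A × A') × (ℤ × ℤ)) (ℤ × ℤ))) = (cross u u').natAbs := by
      rw [absDetOn_fin_two_prod]
      simp only [LinearMap.comp_apply, hβ]
      simp [E, cross]
      simp only [Prod.mk_zero_zero, map_zero]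
      -- The first column of the 2×2 block is `-u`, because the gluing forms are differences.
      rw [← Int.natAbs_neg]
      congr 1
      ring
    have h6 : absDetOn (fun j => (G j).comp
        (LinearMap.inr ℤ (A × A') (ℤ × ℤ))) = c.natAbs * c'.natAbs := by
      rw [absDetOn_unit, absDetOn_unit] at h4
      simp only [LinearMap.smul_apply, LinearMap.id_apply, LinearMap.comp_apply,
        LinearMap.inr_apply, LinearMap.snd_apply, smul_eq_mul, mul_one] at h4
      rw [← h4]
      congr 1
      ext (j | j) <;> simp [G]
    have h7 : absDetOn (fun j : m' => ((f' j).comp (LinearMap.snd ℤ A A')).comp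
        (LinearMap.inr ℤ A A')) = absDetOn f' := by
      congr 1
    rw [h5, h6, h7]
    ring
  · rintro (((i | i) | (i | i)) | i) w
    · simp [hm, E, F]
    · simp [hm', E, F]
    · simp [hα, E, G, mul_comm]
    · simp [hα', E, G, mul_comm]
    · simp

end AbsDetOn

namespace MarkedGraph

variable {ι : Type}

/-! ### Sides of a bounded edge of a tree -/

theorem onSide_left (C : MarkedGraph ι) (a b : C.V) : C.OnSide a b a :=
  SimpleGraph.Reachable.refl a

theorem onSide_iff_of_adj (C : MarkedGraph ι) (a b : C.V) {s t : C.V} (h : C.graph.Adj s t)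
    (hne : s(s, t) ≠ s(a, b)) : C.OnSide a b s ↔ C.OnSide a b t := by
  have hadj : (C.graph.deleteEdges {s(a, b)}).Adj s t := by
    rw [SimpleGraph.deleteEdges_adj]
    exact ⟨h, hne⟩
  exact ⟨fun h' => h'.trans hadj.reachable, fun h' => h'.trans hadj.symm.reachable⟩

/-- Every edge of a tree is a bridge. -/
theorem not_onSide_right {C : MarkedGraph ι} (hT : C.graph.IsTree) {a b : C.V}
    (h : C.graph.Adj a b) : ¬ C.OnSide a b b := by
  have := SimpleGraph.isAcyclic_iff_forall_adj_isBridge.mp hT.isAcyclic h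
  rw [SimpleGraph.isBridge_iff] at this
  exact this

theorem onSide_symm_disjoint {C : MarkedGraph ι} (hT : C.graph.IsTree) {a b v : C.V}
    (h : C.graph.Adj a b) (h₁ : C.OnSide a b v) (h₂ : C.OnSide b a v) : False := by
  refine not_onSide_right hT h (SimpleGraph.Reachable.trans h₁ ?_)
  have h₃ := h₂.symm
  rwa [Sym2.eq_swap] at h₃

/-- A property of vertices that is invariant under adjacency holds everywhere, if it holds somewhere. -/
theorem forall_of_adj {V : Type} {G : SimpleGraph V} (hG : G.Preconnected) {P : V → Prop}
    (hP : ∀ s t, G.Adj s t → P s → P t) {r : V} (hr : P r) (v : V) : P v := by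
  obtain ⟨p⟩ := hG r v
  induction p with
  | nil => exact hr
  | cons h _ ih => exact ih (hP _ _ h hr)

theorem onSide_or {C : MarkedGraph ι} (hT : C.graph.IsTree) {a b : C.V} (h : C.graph.Adj a b)
    (v : C.V) : C.OnSide a b v ∨ C.OnSide b a v := by
  refine forall_of_adj hT.connected.preconnected (P := fun v => C.OnSide a b v ∨ C.OnSide b a v)
    (fun s t hst hs => ?_) (Or.inl (C.onSide_left a b)) v
  by_cases he : s(s, t) = s(a, b)
  · rcases Sym2.eq_iff.mp he with ⟨rfl, rfl⟩ | ⟨rfl, rfl⟩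
    · exact Or.inr (C.onSide_left _ _)
    · exact Or.inl (C.onSide_left _ _)
  · rw [← C.onSide_iff_of_adj a b hst he,
      ← C.onSide_iff_of_adj b a hst (by rwa [Sym2.eq_swap (a := b)])]
    exact hs

theorem onSide_comm_iff_not {C : MarkedGraph ι} (hT : C.graph.IsTree) {a b : C.V}
    (h : C.graph.Adj a b) (v : C.V) : C.OnSide b a v ↔ ¬ C.OnSide a b v :=
  ⟨fun h₂ h₁ => onSide_symm_disjoint hT h h₁ h₂, fun h₁ => (onSide_or hT h v).resolve_left h₁⟩

/-! ### Deformations and coordinates -/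

theorem lengthCoeff_mk (C : MarkedGraph ι) (r t : C.V) {a b : C.V} (h : C.graph.Adj a b) :
    C.lengthCoeff r t ⟨s(a, b), h⟩ =
      (if C.OnSide a b r ∧ C.OnSide b a t then C.dir a b else 0) +
        (if C.OnSide b a r ∧ C.OnSide a b t then C.dir b a else 0) := by
  rw [lengthCoeff, Finset.sum_filter,
    ← Finset.sum_subset (Finset.subset_univ {(a, b), (b, a)}), Finset.sum_pair]
  · simp [Sym2.eq_swap]
  · intro hab
    exact h.ne (Prod.ext_iff.mp hab).1
  · rintro ⟨p, q⟩ - hpq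
    rw [if_neg]
    rintro ⟨h', -⟩
    rcases Sym2.eq_iff.mp h' with ⟨rfl, rfl⟩ | ⟨rfl, rfl⟩ <;> simp at hpq

/-- The paths from `r` to `s` and to `t` differ only in the edge `st`. If `r` is on the side of `t`,
that edge leaves the path instead of entering it, and antisymmetry of `dir` gives the same formula.
-/
theorem lengthCoeff_of_adj {C : MarkedGraph ι} (hT : C.graph.IsTree)
    (hd : ∀ a b, C.graph.Adj a b → C.dir b a = - C.dir a b) (r : C.V) {s t : C.V}
    (h : C.graph.Adj s t) (e : C.graph.edgeSet) :
    C.lengthCoeff r t e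
      = C.lengthCoeff r s e + if (e : Sym2 C.V) = s(s, t) then C.dir s t else 0 := by
  obtain ⟨e, he⟩ := e
  by_cases hst : e = s(s, t)
  · subst hst
    rw [C.lengthCoeff_mk r t h, C.lengthCoeff_mk r s h]
    have h₁ := not_onSide_right hT h
    have h₂ := not_onSide_right hT h.symm
    have h₃ := C.onSide_left s t
    have h₄ := C.onSide_left t s
    rcases onSide_or hT h r with hr | hr
    · have hr' : ¬ C.OnSide t s r := fun h' => onSide_symm_disjoint hT h hr h'
      simp [h₁, h₂, h₃, h₄, hr, hr']
    · have hr' : ¬ C.OnSide s t r := fun h' => onSide_symm_disjoint hT h h' hr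
      simp [h₁, h₂, h₃, h₄, hr, hr', hd s t h]
  · induction e using Sym2.ind with
    | _ a b =>
      have h' : C.graph.Adj a b := he
      have h₁ := C.onSide_iff_of_adj a b h (Ne.symm hst)
      have h₂ := C.onSide_iff_of_adj b a h (by rw [Sym2.eq_swap (a := b)]; exact Ne.symm hst)
      rw [C.lengthCoeff_mk r t h', C.lengthCoeff_mk r s h', h₁, h₂]
      simp [hst]

theorem lengthCoeff_self {C : MarkedGraph ι} (hT : C.graph.IsTree) (r : C.V)
    (e : C.graph.edgeSet) : C.lengthCoeff r r e = 0 := by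
  obtain ⟨e, he⟩ := e
  induction e using Sym2.ind with
  | _ a b =>
    have h : C.graph.Adj a b := he
    rw [C.lengthCoeff_mk r r h, if_neg, if_neg, add_zero]
    · exact fun h' => onSide_symm_disjoint hT h h'.2 h'.1
    · exact fun h' => onSide_symm_disjoint hT h h'.1 h'.2

theorem sum_mul_evCoeff_of_adj {C : MarkedGraph ι} (hT : C.graph.IsTree)
    (hd : ∀ a b, C.graph.Adj a b → C.dir b a = - C.dir a b) (r : C.V) {s t : C.V}
    (h : C.graph.Adj s t) (c : Fin 2 ⊕ C.graph.edgeSet → ℤ) (k : Fin 2) :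
    ∑ i, c i * C.evCoeff r t i k
      = ∑ i, c i * C.evCoeff r s i k + c (.inr ⟨s(s, t), h⟩) * C.dir s t k := by
  simp only [Fintype.sum_sum_type, evCoeff]
  rw [add_assoc]
  congr 1
  simp_rw [lengthCoeff_of_adj hT hd r h]
  simp only [Pi.add_apply, mul_add, Finset.sum_add_distrib]
  congr 1
  rw [Finset.sum_eq_single ⟨s(s, t), h⟩]
  · simp
  · intro e _ he
    have : (e : Sym2 C.V) ≠ s(s, t) := fun h' => he (Subtype.ext h')
    simp [this]
  · simp

/-- The integral points of the linear span of the cell of `C`: integral positions of all vertices and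
integral lengths of all bounded edges that are compatible with the direction vectors of `C`. -/
def deformations (C : MarkedGraph ι) : Submodule ℤ ((C.V → Fin 2 → ℤ) × (C.V → C.V → ℤ)) where
  carrier := {w | (∀ s t, w.2 s t = w.2 t s) ∧ (∀ s t, ¬ C.graph.Adj s t → w.2 s t = 0) ∧
    ∀ s t, C.graph.Adj s t → ∀ k, w.1 t k = w.1 s k + w.2 s t * C.dir s t k}
  add_mem' := by
    rintro x y ⟨hx₁, hx₂, hx₃⟩ ⟨hy₁, hy₂, hy₃⟩
    refine ⟨fun s t => ?_, fun s t h => ?_, fun s t h k => ?_⟩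
    · simp [hx₁ s t, hy₁ s t]
    · simp [hx₂ s t h, hy₂ s t h]
    · simp only [Prod.fst_add, Pi.add_apply, Prod.snd_add, hx₃ s t h k, hy₃ s t h k]
      ring
  zero_mem' := by simp
  smul_mem' := by
    rintro c x ⟨hx₁, hx₂, hx₃⟩
    refine ⟨fun s t => ?_, fun s t h => ?_, fun s t h k => ?_⟩
    · simp [hx₁ s t]
    · simp [hx₂ s t h]
    · simp only [Prod.smul_fst, Pi.smul_apply, Prod.smul_snd, hx₃ s t h k, smul_eq_mul]
      ring

/-- The position of a vertex, as a linear form on deformations. -/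
def position (C : MarkedGraph ι) (t : C.V) (k : Fin 2) : C.deformations →ₗ[ℤ] ℤ where
  toFun w := w.1.1 t k
  map_add' _ _ := rfl
  map_smul' _ _ := rfl

/-- The length of a bounded edge, as a linear form on deformations. -/
def edgeLength (C : MarkedGraph ι) (s t : C.V) : C.deformations →ₗ[ℤ] ℤ where
  toFun w := w.1.2 s t
  map_add' _ _ := rfl
  map_smul' _ _ := rfl

/-- Coordinates on the deformations of a tree: the position of the root vertex and the lengths of the
bounded edges. -/
def coordEquiv (C : MarkedGraph ι) (hT : C.graph.IsTree)
    (hd : ∀ a b, C.graph.Adj a b → C.dir b a = - C.dir a b) (r : C.V) :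
    C.deformations ≃ₗ[ℤ] (Fin 2 ⊕ C.graph.edgeSet → ℤ) where
  toFun w := Sum.elim (w.1.1 r) fun e => w.1.2 (Quot.out (e : Sym2 C.V)).1 (Quot.out (e : Sym2 C.V)).2
  map_add' x y := by
    ext (i | i) <;> simp
  map_smul' c x := by
    ext (i | i) <;> simp
  invFun c := ⟨(fun t k => ∑ i, c i * C.evCoeff r t i k,
      fun s t => if h : C.graph.Adj s t then c (.inr ⟨s(s, t), h⟩) else 0), by
    refine ⟨fun s t => ?_, fun s t h => by simp [h], fun s t h k => ?_⟩
    · by_cases h : C.graph.Adj s t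
      · simp only [h, h.symm, dif_pos]
        congr 2
        exact Subtype.ext Sym2.eq_swap
      · have h' : ¬ C.graph.Adj t s := fun h' => h h'.symm
        simp [h, h']
    · simp only [sum_mul_evCoeff_of_adj hT hd r h, h, dif_pos]⟩
  left_inv w := by
    obtain ⟨⟨p, l⟩, h₁, h₂, h₃⟩ := w
    -- `Quot.out` picks an arbitrary orientation of the edge, which is harmless as lengths are
    -- symmetric.
    have hl : ∀ s t (h : C.graph.Adj s t), l (Quot.out s(s, t)).1 (Quot.out s(s, t)).2 = l s t := by
      intro s t h
      have : s((Quot.out s(s, t)).1, (Quot.out s(s, t)).2) = s(s, t) := Quot.out_eq s(s, t)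
      rcases Sym2.eq_iff.mp this with ⟨h', h''⟩ | ⟨h', h''⟩
      · rw [h', h'']
      · rw [h', h'']
        exact h₁ t s
    refine Subtype.ext (Prod.ext ?_ ?_)
    · refine funext fun t => ?_
      refine forall_of_adj hT.connected.preconnected (r := r) (P := fun t =>
        (fun k => ∑ i, (Sum.elim (p r) fun e : C.graph.edgeSet =>
          l (Quot.out (e : Sym2 C.V)).1 (Quot.out (e : Sym2 C.V)).2) i * C.evCoeff r t i k) = p t)
        (fun s t h hs => ?_) ?_ t
      · funext k
        rw [sum_mul_evCoeff_of_adj hT hd r h]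
        refine Eq.trans ?_ (h₃ s t h k).symm
        simp only [← hs, Sum.elim_inr, hl s t h]
      · funext k
        simp [Fintype.sum_sum_type, evCoeff, lengthCoeff_self hT, Pi.single_apply]
    · funext s t
      by_cases h : C.graph.Adj s t
      · simp [h, hl s t h]
      · simpa [h] using (h₂ s t h).symm
  right_inv c := by
    ext (k | ⟨e, he⟩)
    · simp [Fintype.sum_sum_type, evCoeff, lengthCoeff_self hT, Pi.single_apply]
    · have h' : s((Quot.out e).1, (Quot.out e).2) = e := Quot.out_eq e
      have h : C.graph.Adj (Quot.out e).1 (Quot.out e).2 := by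
        rw [← SimpleGraph.mem_edgeSet, h']
        exact he
      simp only [Sum.elim_inr, h, dif_pos]
      congr 2
      exact Subtype.ext h'

/-- The basis of the deformations of a tree given by the root position and the edge lengths. -/
def coordBasis (C : MarkedGraph ι) (hT : C.graph.IsTree)
    (hd : ∀ a b, C.graph.Adj a b → C.dir b a = - C.dir a b) (r : C.V) :
    Module.Basis (Fin 2 ⊕ C.graph.edgeSet) ℤ C.deformations :=
  .ofEquivFun (C.coordEquiv hT hd r)

theorem position_coordBasis (C : MarkedGraph ι) (hT : C.graph.IsTree)
    (hd : ∀ a b, C.graph.Adj a b → C.dir b a = - C.dir a b) (r t : C.V) (k : Fin 2)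
    (i : Fin 2 ⊕ C.graph.edgeSet) :
    C.position t k (C.coordBasis hT hd r i) = C.evCoeff r t i k := by
  simp only [coordBasis, Module.Basis.coe_ofEquivFun, position, coordEquiv, LinearMap.coe_mk,
    AddHom.coe_mk, LinearEquiv.coe_symm_mk', Pi.single_apply, ite_mul, one_mul, zero_mul,
    Finset.sum_ite_eq', Finset.mem_univ, if_true]

theorem edgeLength_coordBasis_inl (C : MarkedGraph ι) (hT : C.graph.IsTree)
    (hd : ∀ a b, C.graph.Adj a b → C.dir b a = - C.dir a b) (r s t : C.V) (k : Fin 2) :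
    C.edgeLength s t (C.coordBasis hT hd r (.inl k)) = 0 := by
  simp [coordBasis, edgeLength, coordEquiv]

theorem edgeLength_coordBasis_inr (C : MarkedGraph ι) (hT : C.graph.IsTree)
    (hd : ∀ a b, C.graph.Adj a b → C.dir b a = - C.dir a b) (r : C.V) (e : C.graph.edgeSet)
    (s t : C.V) (h : C.graph.Adj s t) :
    C.edgeLength s t (C.coordBasis hT hd r (.inr e)) = if (e : Sym2 C.V) = s(s, t) then 1 else 0 := by
  simp [coordBasis, edgeLength, coordEquiv, h, Pi.single_apply, Subtype.ext_iff, eq_comm]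

theorem finrank_deformations (C : MarkedGraph ι) (hT : C.graph.IsTree)
    (hd : ∀ a b, C.graph.Adj a b → C.dir b a = - C.dir a b) :
    Module.finrank ℤ C.deformations = Fintype.card C.V + 1 := by
  obtain ⟨r⟩ := hT.connected.nonempty
  rw [Module.finrank_eq_card_basis (C.coordBasis hT hd r), Fintype.card_sum, Fintype.card_fin]
  have := hT.card_edgeFinset
  rw [SimpleGraph.edgeFinset_card] at this
  omega

/-- Removes the root vertex, chosen arbitrarily in `evMult`, from all later arguments. -/
theorem evMult_eq [Fintype ι] (C : MarkedGraph ι) (hT : C.graph.IsTree)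
    (hd : ∀ a b, C.graph.Adj a b → C.dir b a = - C.dir a b) :
    C.evMult = absDetOn fun i : ι × Fin 2 => C.position (C.mark i.1) i.2 := by
  have h := hT.connected.nonempty
  rw [evMult, dif_pos h, absDetOn_eq_basis _ (C.coordBasis hT hd h.some)]
  congr 1
  ext i c
  exact (C.position_coordBasis hT hd _ _ _ _).symm

end MarkedGraph

namespace MarkedGraph

variable {ι : Type}

/-! ### Flags -/

/-- A bounded edge (given by its other vertex), an end or a marking is attached at `v`. -/
def IsFlag (C : MarkedGraph ι) (v : C.V) : C.V ⊕ C.ends ⊕ ι → Prop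
  | .inl w => C.graph.Adj v w
  | .inr (.inl e) => C.endAt e = v
  | .inr (.inr i) => C.mark i = v

/-- The direction vector of a flag at `v`. -/
def flagDir (C : MarkedGraph ι) (v : C.V) : C.V ⊕ C.ends ⊕ ι → Fin 2 → ℤ
  | .inl w => C.dir v w
  | .inr (.inl e) => C.endDir e
  | .inr (.inr _) => 0

/-- Markings are flags of direction 0 for `flagDir` but are not seen by `IsFlagDir`; the two notions
agree away from 0. -/
theorem isFlagDir_iff (C : MarkedGraph ι) (v : C.V) {u : Fin 2 → ℤ} (hu : u ≠ 0) :
    C.IsFlagDir v u ↔ ∃ f, C.IsFlag v f ∧ C.flagDir v f = u := by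
  constructor
  · rintro (⟨w, h⟩ | ⟨e, h⟩)
    · exact ⟨.inl w, h⟩
    · exact ⟨.inr (.inl e), h⟩
  · rintro ⟨w | e | i, h⟩
    · exact Or.inl ⟨w, h⟩
    · exact Or.inr ⟨e, h⟩
    · exact absurd h.2.symm hu

/-- If the flags at the vertex of the marking `x` have no directions other than `0`, `u` and `-u`, then
the edge on which `x` lies has direction `u`, up to sign. -/
theorem edgeDir_eq_or_eq_neg (C : MarkedGraph ι) (x : ι) (u : Fin 2 → ℤ)
    (hu : u ≠ 0 → C.IsFlagDir (C.mark x) u)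
    (h : ∀ f, C.IsFlag (C.mark x) f →
      C.flagDir (C.mark x) f = 0 ∨ C.flagDir (C.mark x) f = u ∨ C.flagDir (C.mark x) f = -u) :
    C.edgeDir x = u ∨ C.edgeDir x = -u := by
  unfold edgeDir
  split_ifs with h'
  · obtain ⟨h₁, h₂⟩ := h'.choose_spec
    obtain ⟨f, hf, hf'⟩ := (C.isFlagDir_iff _ h₁).mp h₂
    rcases h f hf with h₃ | h₃ | h₃
    · exact absurd (hf'.symm.trans h₃) h₁
    · exact Or.inl (hf'.symm.trans h₃)
    · exact Or.inr (hf'.symm.trans h₃)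
  · left
    by_contra h₀
    exact h' ⟨u, fun hu₀ => h₀ hu₀.symm, hu fun hu₀ => h₀ hu₀.symm⟩

/-- The equality is exact and not just up to sign: the same predicate leads to the same choice. -/
theorem edgeDir_congr {κ : Type} (C : MarkedGraph ι) (C' : MarkedGraph κ) (x : ι) (x' : κ)
    (h : ∀ u, u ≠ 0 → (C'.IsFlagDir (C'.mark x') u ↔ C.IsFlagDir (C.mark x) u)) :
    C'.edgeDir x' = C.edgeDir x := by
  have : (fun u => u ≠ 0 ∧ C'.IsFlagDir (C'.mark x') u)
      = fun u => u ≠ 0 ∧ C.IsFlagDir (C.mark x) u := by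
    funext u
    by_cases hu : u = 0
    · simp [hu]
    · simp [hu, h u hu]
  unfold edgeDir
  simp only [this]

/-- A tree all of whose vertices are `3`-valent, with a balanced map to the plane. -/
structure IsTrivalent (C : MarkedGraph ι) : Prop where
  isTree : C.graph.IsTree
  dir_symm : ∀ a b, C.graph.Adj a b → C.dir b a = - C.dir a b
  valence_eq : ∀ v, C.valence v = 3
  balanced : ∀ v, (∑ w with C.graph.Adj v w, C.dir v w) + (∑ e with C.endAt e = v, C.endDir e) = 0

section Flags

variable [Fintype ι]

/-- The flags at a vertex. -/
def flags (C : MarkedGraph ι) (v : C.V) : Finset (C.V ⊕ C.ends ⊕ ι) := {f | C.IsFlag v f}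

@[simp]
theorem mem_flags (C : MarkedGraph ι) (v : C.V) (f : C.V ⊕ C.ends ⊕ ι) :
    f ∈ C.flags v ↔ C.IsFlag v f := by
  simp [flags]

theorem card_flags (C : MarkedGraph ι) (v : C.V) : (C.flags v).card = C.valence v := by
  rw [flags, ← Fintype.card_subtype, ← Nat.card_eq_fintype_card, Nat.card_congr (Equiv.subtypeSum),
    Nat.card_sum, Nat.card_congr (Equiv.subtypeSum (p := fun f => C.IsFlag v (.inr f))), Nat.card_sum,
    ← add_assoc]
  rfl

theorem sum_flagDir (C : MarkedGraph ι) (v : C.V) :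
    ∑ f ∈ C.flags v, C.flagDir v f
      = (∑ w with C.graph.Adj v w, C.dir v w) + ∑ e with C.endAt e = v, C.endDir e := by
  rw [flags, Finset.sum_filter, Finset.sum_filter, Finset.sum_filter, Fintype.sum_sum_type,
    Fintype.sum_sum_type]
  simp only [IsFlag, flagDir]
  congr 1
  exact add_eq_left.mpr (Finset.sum_eq_zero fun i _ => ite_self _)

theorem IsTrivalent.card_flags {C : MarkedGraph ι} (hC : C.IsTrivalent) (v : C.V) :
    (C.flags v).card = 3 :=
  (C.card_flags v).trans (hC.valence_eq v)

theorem IsTrivalent.sum_flagDir {C : MarkedGraph ι} (hC : C.IsTrivalent) (v : C.V) :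
    ∑ f ∈ C.flags v, C.flagDir v f = 0 :=
  (C.sum_flagDir v).trans (hC.balanced v)

theorem isTrivalent_of_flags {C : MarkedGraph ι} (hT : C.graph.IsTree)
    (hd : ∀ a b, C.graph.Adj a b → C.dir b a = - C.dir a b)
    (hcard : ∀ v, (C.flags v).card = 3) (hsum : ∀ v, ∑ f ∈ C.flags v, C.flagDir v f = 0) :
    C.IsTrivalent :=
  ⟨hT, hd, fun v => (C.card_flags v).symm.trans (hcard v),
    fun v => (C.sum_flagDir v).symm.trans (hsum v)⟩

/-- Double counting of flags: three per vertex, two per bounded edge, one per end and per marking,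
while a tree has one edge fewer than vertices. -/
theorem card_V_of_isTrivalent {C : MarkedGraph ι} (hC : C.IsTrivalent) :
    Fintype.card C.V + 2 = Fintype.card C.ends + Fintype.card ι := by
  have h₁ : ∑ v, (C.flags v).card = 3 * Fintype.card C.V := by
    simp [hC.card_flags, mul_comm]
  have h₂ : ∑ v, (C.flags v).card
      = ∑ v, C.graph.degree v + Fintype.card C.ends + Fintype.card ι := by
    have : ∀ v, (C.flags v).card = C.graph.degree v + Fintype.card {e // C.endAt e = v}
        + Fintype.card {i // C.mark i = v} := by
      intro v
      rw [C.card_flags, valence, Nat.card_eq_fintype_card, Nat.card_eq_fintype_card,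
        Nat.card_eq_fintype_card, ← SimpleGraph.card_neighborSet_eq_degree]
      congr 2
    simp_rw [this, Finset.sum_add_distrib, ← Fintype.card_sigma]
    rw [Fintype.card_congr (Equiv.sigmaFiberEquiv C.endAt),
      Fintype.card_congr (Equiv.sigmaFiberEquiv C.mark)]
  have h₃ := C.graph.sum_degrees_eq_twice_card_edges
  have h₄ := hC.isTree.card_edgeFinset
  omega

end Flags

/-! ### Straightening a `2`-valent vertex -/

/-- If `st` were an edge, the path through `v` would survive its removal, so `st` would not be a
bridge. Hence merging the edges at `v` never produces a double edge. -/
theorem not_adj_of_path {C : MarkedGraph ι} (hT : C.graph.IsTree) {s v t : C.V}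
    (h₁ : C.graph.Adj s v) (h₂ : C.graph.Adj v t) (hst : s ≠ t) : ¬ C.graph.Adj s t := by
  intro h
  refine not_onSide_right hT h ?_
  rw [← C.onSide_iff_of_adj s t h₂, ← C.onSide_iff_of_adj s t h₁]
  · exact C.onSide_left s t
  · intro h'
    rcases Sym2.eq_iff.mp h' with ⟨-, h''⟩ | ⟨h'', -⟩
    · exact h₂.ne h''
    · exact hst h''
  · intro h'
    rcases Sym2.eq_iff.mp h' with ⟨h'', -⟩ | ⟨h'', -⟩
    · exact h₁.ne h''.symm
    · exact h₂.ne h''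

section Straighten

variable (C : MarkedGraph ι) (v w : C.V) (hvw : C.graph.Adj v w)

theorem straighten_adj (s t : {u : C.V // u ≠ v}) :
    (C.straighten v w hvw).graph.Adj s t ↔
      s ≠ t ∧ (C.graph.Adj s t ∨ (C.graph.Adj s v ∧ C.graph.Adj v t)) := by
  simp only [straighten, SimpleGraph.fromRel_adj]
  constructor
  · rintro ⟨h, (h' | h') | (h' | h')⟩
    · exact ⟨h, Or.inl h'⟩
    · exact ⟨h, Or.inr h'⟩
    · exact ⟨h, Or.inl h'.symm⟩
    · exact ⟨h, Or.inr ⟨h'.2.symm, h'.1.symm⟩⟩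
  · rintro ⟨h, h'⟩
    exact ⟨h, Or.inl h'⟩

theorem straighten_endAt_eq (e : C.ends) (u : {u : C.V // u ≠ v}) :
    (C.straighten v w hvw).endAt e = u ↔ C.endAt e = u ∨ (C.endAt e = v ∧ w = u) := by
  simp only [straighten]
  split_ifs with h
  · simp [h, u.2.symm, Subtype.ext_iff]
  · simp [h, Subtype.ext_iff]

theorem straighten_mark_eq (i : ι) (u : {u : C.V // u ≠ v}) :
    (C.straighten v w hvw).mark i = u ↔ C.mark i = u ∨ (C.mark i = v ∧ w = u) := by
  simp only [straighten]
  split_ifs with h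
  · simp [h, u.2.symm, Subtype.ext_iff]
  · simp [h, Subtype.ext_iff]

variable {C v w}

/-- The map `ρ` contracting `vw` sends each edge to an edge or to a single vertex, so it transports
reachability. -/
theorem straighten_preconnected (hC : C.graph.Preconnected) :
    (C.straighten v w hvw).graph.Preconnected := by
  let ρ : C.V → (C.straighten v w hvw).V := fun u => if h : u = v then ⟨w, hvw.ne'⟩ else ⟨u, h⟩
  have hρ : ∀ u : (C.straighten v w hvw).V, ρ u.1 = u := fun u => dif_neg u.2
  intro s t
  have key : ∀ u, (C.straighten v w hvw).graph.Reachable (ρ s.1) (ρ u) := by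
    refine forall_of_adj hC (r := s.1) (fun a b hab ha => ha.trans ?_)
      (SimpleGraph.Reachable.refl _)
    by_cases he : ρ a = ρ b
    · rw [he]
    · refine SimpleGraph.Adj.reachable ((C.straighten_adj v w hvw _ _).mpr ⟨he, ?_⟩)
      by_cases ha : a = v <;> by_cases hb : b = v
      · exact absurd (ha.trans hb.symm) hab.ne
      · right
        subst ha
        simp [ρ, hb, hvw.symm, hab]
      · right
        subst hb
        simp [ρ, ha, hvw, hab]
      · left
        simp [ρ, ha, hb, hab]
  have := key t.1
  rwa [hρ, hρ] at this

theorem straighten_card_V :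
    Fintype.card (C.straighten v w hvw).V + 1 = Fintype.card C.V := by
  have h : Fintype.card {u : C.V // u ≠ v} = Fintype.card C.V - 1 := by
    rw [Fintype.card_subtype_compl, Fintype.card_subtype_eq]
  have h₂ : Fintype.card (C.straighten v w hvw).V = Fintype.card {u : C.V // u ≠ v} :=
    Fintype.card_congr (Equiv.refl _)
  have h₁ : 0 < Fintype.card C.V := Fintype.card_pos_iff.mpr ⟨v⟩
  omega

/-- By connectedness it is enough to bound the number of edges. Each new edge is the image under the
contraction `ρ` of an old edge other than `vw`; this is where `h₂` enters, as a merged edge must use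
`vw`. So one vertex and at least one edge disappear. -/
theorem straighten_isTree (hC : C.graph.IsTree)
    (h₂ : ∀ s t, C.graph.Adj v s → C.graph.Adj v t → s ≠ t → s = w ∨ t = w) :
    (C.straighten v w hvw).graph.IsTree := by
  have hconn : (C.straighten v w hvw).graph.Connected :=
    { preconnected := straighten_preconnected hvw hC.connected.preconnected
      nonempty := ⟨⟨w, hvw.ne'⟩⟩ }
  rw [SimpleGraph.isTree_iff_connected_and_card]
  refine ⟨hconn, le_antisymm ?_ hconn.card_vert_le_card_edgeSet_add_one⟩
  let ρ : C.V → (C.straighten v w hvw).V := fun u => if h : u = v then ⟨w, hvw.ne'⟩ else ⟨u, h⟩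
  have hρ : ∀ u : (C.straighten v w hvw).V, ρ u.1 = u := fun u => dif_neg u.2
  have hρv : ρ v = ⟨w, hvw.ne'⟩ := dif_pos rfl
  have hsub : (C.straighten v w hvw).graph.edgeFinset
      ⊆ (C.graph.edgeFinset.erase s(v, w)).image (Sym2.map ρ) := by
    intro e he
    rw [SimpleGraph.mem_edgeFinset] at he
    induction e using Sym2.ind with
    | _ s t =>
      obtain ⟨hst, h | ⟨hs, ht⟩⟩ := (C.straighten_adj v w hvw s t).mp he
      · refine Finset.mem_image.mpr ⟨s(s.1, t.1), ?_, by rw [Sym2.map_mk, hρ, hρ]⟩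
        refine Finset.mem_erase.mpr ⟨fun h' => ?_, SimpleGraph.mem_edgeFinset.mpr h⟩
        rcases Sym2.eq_iff.mp h' with ⟨h'', -⟩ | ⟨-, h''⟩
        · exact s.2 h''
        · exact t.2 h''
      · have hst' : s.1 ≠ t.1 := fun h' => hst (Subtype.ext h')
        rcases h₂ s.1 t.1 hs.symm ht hst' with h | h
        · refine Finset.mem_image.mpr ⟨s(v, t.1), ?_, ?_⟩
          · refine Finset.mem_erase.mpr ⟨fun h' => ?_, SimpleGraph.mem_edgeFinset.mpr ht⟩
            rcases Sym2.eq_iff.mp h' with ⟨-, h''⟩ | ⟨h'', -⟩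
            · exact hst' (h.trans h''.symm)
            · exact hvw.ne h''
          · rw [Sym2.map_mk, hρ, show ρ v = s from hρv.trans (Subtype.ext h.symm)]
        · refine Finset.mem_image.mpr ⟨s(s.1, v), ?_, ?_⟩
          · refine Finset.mem_erase.mpr ⟨fun h' => ?_, SimpleGraph.mem_edgeFinset.mpr hs⟩
            rcases Sym2.eq_iff.mp h' with ⟨h'', -⟩ | ⟨h'', -⟩
            · exact s.2 h''
            · exact hst' (h''.trans h.symm)
          · rw [Sym2.map_mk, hρ, show ρ v = t from hρv.trans (Subtype.ext h.symm)]
  have h₃ := (Finset.card_le_card hsub).trans Finset.card_image_le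
  rw [Finset.card_erase_of_mem (SimpleGraph.mem_edgeFinset.mpr hvw)] at h₃
  have h₄ := hC.card_edgeFinset
  have h₅ := straighten_card_V (C := C) hvw
  have h₆ : 0 < C.graph.edgeFinset.card :=
    Finset.card_pos.mpr ⟨s(v, w), SimpleGraph.mem_edgeFinset.mpr hvw⟩
  rw [Nat.card_eq_fintype_card, Nat.card_eq_fintype_card, ← SimpleGraph.edgeFinset_card]
  omega

section TwoFlags

variable [Fintype ι]

theorem eq_or_eq_of_card_flags (hcard : (C.flags v).card = 2) {f g h : C.V ⊕ C.ends ⊕ ι}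
    (_hf : C.IsFlag v f) (hg : C.IsFlag v g) (hh : C.IsFlag v h) (hfg : f ≠ g) : h = f ∨ h = g := by
  by_contra! hne
  have : ({f, g, h} : Finset _) ⊆ C.flags v := by
    intro x hx
    simp only [Finset.mem_insert, Finset.mem_singleton] at hx
    rcases hx with rfl | rfl | rfl <;> simpa
  have := Finset.card_le_card this
  rw [hcard, Finset.card_eq_three.mpr ⟨f, g, h, hfg, hne.1.symm, hne.2.symm, rfl⟩] at this
  omega

theorem flags_eq_pair (hcard : (C.flags v).card = 2) {f g : C.V ⊕ C.ends ⊕ ι}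
    (hf : C.IsFlag v f) (hg : C.IsFlag v g) (hfg : f ≠ g) : C.flags v = {f, g} := by
  ext h
  simp only [mem_flags, Finset.mem_insert, Finset.mem_singleton]
  refine ⟨fun hh => eq_or_eq_of_card_flags hcard hf hg hh hfg, ?_⟩
  rintro (rfl | rfl) <;> assumption

theorem exists_other_flag (hcard : (C.flags v).card = 2) (f : C.V ⊕ C.ends ⊕ ι) :
    ∃ g, C.IsFlag v g ∧ f ≠ g := by
  obtain ⟨g, hg, hgf⟩ := Finset.exists_mem_ne (by rw [hcard]; norm_num) f
  exact ⟨g, by simpa using hg, hgf.symm⟩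

theorem flagDir_eq_neg (hcard : (C.flags v).card = 2)
    (hsum : ∑ f ∈ C.flags v, C.flagDir v f = 0) {f g : C.V ⊕ C.ends ⊕ ι}
    (hf : C.IsFlag v f) (hg : C.IsFlag v g) (hfg : f ≠ g) : C.flagDir v g = - C.flagDir v f := by
  rw [flags_eq_pair hcard hf hg hfg, Finset.sum_pair hfg] at hsum
  exact eq_neg_of_add_eq_zero_right hsum

end TwoFlags

end Straighten

end MarkedGraph

namespace MarkedGraph

variable {ι : Type}

/-! ### Flags of a graph with a straightened vertex -/

section StraightenFlags

variable {C : MarkedGraph ι} {v w : C.V} (hvw : C.graph.Adj v w)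

/-- Flags of the straightened graph as flags of the original graph. -/
def straightenFlag (C : MarkedGraph ι) (v w : C.V) (hvw : C.graph.Adj v w) :
    (C.straighten v w hvw).V ⊕ (C.straighten v w hvw).ends ⊕ ι → C.V ⊕ C.ends ⊕ ι :=
  Sum.map Subtype.val id

theorem straightenFlag_injective : Function.Injective (C.straightenFlag v w hvw) :=
  Sum.map_injective.mpr ⟨Subtype.val_injective, Function.injective_id⟩

theorem straightenFlag_ne (f : (C.straighten v w hvw).V ⊕ (C.straighten v w hvw).ends ⊕ ι) :
    C.straightenFlag v w hvw f ≠ .inl v := by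
  rcases f with s | f
  · exact fun h => s.2 (Sum.inl_injective h)
  · exact Sum.inr_ne_inl

theorem exists_straightenFlag_eq {f : C.V ⊕ C.ends ⊕ ι} (hf : f ≠ .inl v) :
    ∃ f', C.straightenFlag v w hvw f' = f := by
  rcases f with s | f
  · exact ⟨.inl ⟨s, fun h => hf (by rw [h])⟩, rfl⟩
  · exact ⟨.inr f, rfl⟩

theorem isFlag_straighten_of_not_adj (u : (C.straighten v w hvw).V) (hu : ¬ C.graph.Adj v u.1)
    (f : (C.straighten v w hvw).V ⊕ (C.straighten v w hvw).ends ⊕ ι) :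
    (C.straighten v w hvw).IsFlag u f ↔ C.IsFlag u.1 (C.straightenFlag v w hvw f) := by
  have hwu : w ≠ u.1 := fun h => hu (h ▸ hvw)
  rcases f with s | e | i
  · refine (C.straighten_adj v w hvw u s).trans ?_
    constructor
    · rintro ⟨-, h | ⟨h, -⟩⟩
      · exact h
      · exact absurd h.symm hu
    · intro h
      exact ⟨fun h' => C.graph.irrefl (h' ▸ h : C.graph.Adj u.1 u.1), Or.inl h⟩
  · refine (C.straighten_endAt_eq v w hvw e u).trans ?_
    simp only [hwu, and_false, or_false]
    exact Iff.rfl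
  · refine (C.straighten_mark_eq v w hvw i u).trans ?_
    simp only [hwu, and_false, or_false]
    exact Iff.rfl

/-- At a neighbour `u` of `v`, the flag towards `v` is replaced by `o`, the flag of `v` pointing
away from `u`. -/
theorem isFlag_straighten_of_adj [Fintype ι] (hcard : (C.flags v).card = 2) (u : (C.straighten v w hvw).V)
    (hu : C.graph.Adj v u.1) {o : C.V ⊕ C.ends ⊕ ι} (ho : C.IsFlag v o) (hou : .inl u.1 ≠ o)
    (f : (C.straighten v w hvw).V ⊕ (C.straighten v w hvw).ends ⊕ ι) :
    (C.straighten v w hvw).IsFlag u f ↔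
      C.IsFlag u.1 (C.straightenFlag v w hvw f) ∨ C.straightenFlag v w hvw f = o := by
  have key : ∀ g, C.IsFlag v g → g ≠ .inl u.1 → g = o := fun g hg hgu =>
    (eq_or_eq_of_card_flags hcard (show C.IsFlag v (.inl u.1) from hu) ho hg hou).resolve_left hgu
  -- If `o` is unbounded, `u` is the only neighbour of `v`, so `straighten` attaches `o` at `u`.
  have hwu : ∀ x, o = .inr x → w = u.1 := by
    rintro x rfl
    by_contra h
    exact Sum.inl_ne_inr (key (.inl w) hvw fun h' => h (Sum.inl_injective h'))
  rcases f with s | e | i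
  · refine (C.straighten_adj v w hvw u s).trans ?_
    constructor
    · rintro ⟨hus, h | ⟨-, h⟩⟩
      · exact Or.inl h
      · exact Or.inr (key (.inl s.1) h fun h' => hus (Subtype.ext (Sum.inl_injective h').symm))
    · rintro (h | rfl)
      · exact ⟨fun h' => C.graph.irrefl (h' ▸ h : C.graph.Adj u.1 u.1), Or.inl h⟩
      · exact ⟨fun h' => hou (by rw [h']; rfl), Or.inr ⟨hu.symm, ho⟩⟩
  · refine (C.straighten_endAt_eq v w hvw e u).trans ?_
    constructor
    · rintro (h | ⟨h, -⟩)
      · exact Or.inl h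
      · exact Or.inr (key (.inr (.inl e)) h Sum.inr_ne_inl)
    · rintro (h | rfl)
      · exact Or.inl h
      · exact Or.inr ⟨ho, hwu _ rfl⟩
  · refine (C.straighten_mark_eq v w hvw i u).trans ?_
    constructor
    · rintro (h | ⟨h, -⟩)
      · exact Or.inl h
      · exact Or.inr (key (.inr (.inr i)) h Sum.inr_ne_inl)
    · rintro (h | rfl)
      · exact Or.inl h
      · exact Or.inr ⟨ho, hwu _ rfl⟩

theorem other_flag_not_isFlag (hT : C.graph.IsTree) (u : C.V) (hu : C.graph.Adj v u)
    {o : C.V ⊕ C.ends ⊕ ι} (ho : C.IsFlag v o) (hou : .inl u ≠ o) : ¬ C.IsFlag u o := by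
  rcases o with s | e | i
  · exact not_adj_of_path hT hu.symm ho fun h => hou (by rw [h])
  · exact fun h => hu.ne (Eq.trans ho.symm h)
  · exact fun h => hu.ne (Eq.trans ho.symm h)

theorem flagDir_straighten_of_isFlag (u : (C.straighten v w hvw).V)
    (f : (C.straighten v w hvw).V ⊕ (C.straighten v w hvw).ends ⊕ ι)
    (h : C.IsFlag u.1 (C.straightenFlag v w hvw f)) :
    (C.straighten v w hvw).flagDir u f = C.flagDir u.1 (C.straightenFlag v w hvw f) := by
  rcases f with s | e | i
  · exact if_pos h
  · rfl
  · rfl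

theorem flagDir_straighten_of_not_isFlag [Fintype ι] (hd : ∀ a b, C.graph.Adj a b → C.dir b a = - C.dir a b)
    (hcard : (C.flags v).card = 2) (hsum : ∑ f ∈ C.flags v, C.flagDir v f = 0)
    (u : (C.straighten v w hvw).V) (hu : C.graph.Adj v u.1)
    (f : (C.straighten v w hvw).V ⊕ (C.straighten v w hvw).ends ⊕ ι)
    (h : ¬ C.IsFlag u.1 (C.straightenFlag v w hvw f))
    (hf : C.IsFlag v (C.straightenFlag v w hvw f))
    (hfu : .inl u.1 ≠ C.straightenFlag v w hvw f) :
    (C.straighten v w hvw).flagDir u f = C.dir u.1 v := by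
  have h₁ := flagDir_eq_neg hcard hsum (show C.IsFlag v (.inl u.1) from hu) hf hfu
  rcases f with s | e | i
  · exact if_neg h
  · exact h₁.trans (hd v u.1 hu).symm
  · exact h₁.trans (hd v u.1 hu).symm

/-- The flags at a vertex other than the straightened one correspond to each other, with the same
direction vectors. -/
theorem exists_flags_straighten [Fintype ι] (hT : C.graph.IsTree)
    (hd : ∀ a b, C.graph.Adj a b → C.dir b a = - C.dir a b)
    (hcard : (C.flags v).card = 2) (hsum : ∑ f ∈ C.flags v, C.flagDir v f = 0)
    (u : (C.straighten v w hvw).V) :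
    ∃ φ : (C.straighten v w hvw).V ⊕ (C.straighten v w hvw).ends ⊕ ι → C.V ⊕ C.ends ⊕ ι,
      Set.BijOn φ {f | (C.straighten v w hvw).IsFlag u f} {f | C.IsFlag u.1 f} ∧
      ∀ f, (C.straighten v w hvw).IsFlag u f →
        (C.straighten v w hvw).flagDir u f = C.flagDir u.1 (φ f) := by
  by_cases hu : C.graph.Adj v u.1
  · obtain ⟨o, ho, hou⟩ := exists_other_flag hcard (.inl u.1)
    have hflag := isFlag_straighten_of_adj hvw hcard u hu ho hou
    have hno := other_flag_not_isFlag hT u.1 hu ho hou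
    -- The merged flag, the only one not already attached at `u`, corresponds to the old flag from
    -- `u` to `v`.
    refine ⟨fun f => if C.IsFlag u.1 (C.straightenFlag v w hvw f) then C.straightenFlag v w hvw f
      else .inl v, ⟨?_, ?_, ?_⟩, ?_⟩
    · intro f hf
      simp only [Set.mem_ofPred_eq]
      split_ifs with h
      · exact h
      · exact hu.symm
    · intro f hf g hg hfg
      have hf' := (hflag f).mp hf
      have hg' := (hflag g).mp hg
      simp only at hfg
      apply straightenFlag_injective hvw
      split_ifs at hfg with h₁ h₂ h₂
      · exact hfg
      · exact absurd hfg (straightenFlag_ne hvw f)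
      · exact absurd hfg.symm (straightenFlag_ne hvw g)
      · exact (hf'.resolve_left h₁).trans (hg'.resolve_left h₂).symm
    · intro g hg
      by_cases hgv : g = .inl v
      · have hov : o ≠ .inl v := by
          rintro rfl
          exact C.graph.irrefl ho
        obtain ⟨f, hf⟩ := exists_straightenFlag_eq (w := w) hvw hov
        refine ⟨f, (hflag f).mpr (Or.inr hf), ?_⟩
        simp only [hf, hno, if_false, hgv]
      · obtain ⟨f, rfl⟩ := exists_straightenFlag_eq (w := w) hvw hgv
        exact ⟨f, (hflag f).mpr (Or.inl hg), if_pos hg⟩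
    · intro f hf
      simp only
      split_ifs with h
      · exact flagDir_straighten_of_isFlag hvw u f h
      · have hfo := ((hflag f).mp hf).resolve_left h
        exact flagDir_straighten_of_not_isFlag hvw hd hcard hsum u hu f h (hfo ▸ ho) (hfo ▸ hou)
  · have hflag := isFlag_straighten_of_not_adj hvw u hu
    refine ⟨C.straightenFlag v w hvw, ⟨fun f hf => (hflag f).mp hf,
      (straightenFlag_injective hvw).injOn, fun g hg => ?_⟩,
      fun f hf => flagDir_straighten_of_isFlag hvw u f ((hflag f).mp hf)⟩
    have hgv : g ≠ .inl v := by
      rintro rfl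
      exact hu (SimpleGraph.Adj.symm hg)
    obtain ⟨f, rfl⟩ := exists_straightenFlag_eq (w := w) hvw hgv
    exact ⟨f, (hflag f).mpr hg, rfl⟩

end StraightenFlags

/-! ### Correspondences of flags -/

section FlagBijection

variable {κ : Type} {C : MarkedGraph ι} {C' : MarkedGraph κ}
  {v : C.V} {v' : C'.V} {φ : C'.V ⊕ C'.ends ⊕ κ → C.V ⊕ C.ends ⊕ ι}

theorem card_flags_eq_of_bijOn [Fintype ι] [Fintype κ] (hφ : Set.BijOn φ {f | C'.IsFlag v' f} {f | C.IsFlag v f}) :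
    (C'.flags v').card = (C.flags v).card :=
  Finset.card_bij (fun f _ => φ f) (fun f hf => by simpa using hφ.mapsTo (by simpa using hf))
    (fun f hf g hg h => hφ.injOn (by simpa using hf) (by simpa using hg) h)
    (fun g hg => by
      obtain ⟨f, hf, h⟩ := hφ.surjOn (show g ∈ {f | C.IsFlag v f} by simpa using hg)
      exact ⟨f, by simpa using hf, h⟩)

theorem sum_flagDir_eq_of_bijOn [Fintype ι] [Fintype κ] (hφ : Set.BijOn φ {f | C'.IsFlag v' f} {f | C.IsFlag v f})
    (hdir : ∀ f, C'.IsFlag v' f → C'.flagDir v' f = C.flagDir v (φ f)) :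
    ∑ f ∈ C'.flags v', C'.flagDir v' f = ∑ f ∈ C.flags v, C.flagDir v f :=
  Finset.sum_bij (fun f _ => φ f) (fun f hf => by simpa using hφ.mapsTo (by simpa using hf))
    (fun f hf g hg h => hφ.injOn (by simpa using hf) (by simpa using hg) h)
    (fun g hg => by
      obtain ⟨f, hf, h⟩ := hφ.surjOn (show g ∈ {f | C.IsFlag v f} by simpa using hg)
      exact ⟨f, by simpa using hf, h⟩)
    (fun f hf => hdir f (by simpa using hf))

theorem isFlagDir_iff_of_bijOn (hφ : Set.BijOn φ {f | C'.IsFlag v' f} {f | C.IsFlag v f})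
    (hdir : ∀ f, C'.IsFlag v' f → C'.flagDir v' f = C.flagDir v (φ f)) {u : Fin 2 → ℤ}
    (hu : u ≠ 0) : C'.IsFlagDir v' u ↔ C.IsFlagDir v u := by
  rw [C'.isFlagDir_iff _ hu, C.isFlagDir_iff _ hu]
  constructor
  · rintro ⟨f, hf, h⟩
    exact ⟨φ f, hφ.mapsTo hf, (hdir f hf).symm.trans h⟩
  · rintro ⟨g, hg, h⟩
    obtain ⟨f, hf, rfl⟩ := hφ.surjOn hg
    exact ⟨f, hf, (hdir f hf).trans h⟩

end FlagBijection

/-! ### Deformations of a straightened graph -/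

section StraightenDeformations

variable [Fintype ι] {C : MarkedGraph ι} {v w : C.V} (hvw : C.graph.Adj v w)

theorem dir_eq_of_path (hd : ∀ a b, C.graph.Adj a b → C.dir b a = - C.dir a b)
    (hcard : (C.flags v).card = 2) (hsum : ∑ f ∈ C.flags v, C.flagDir v f = 0) {s t : C.V}
    (hs : C.graph.Adj s v) (ht : C.graph.Adj v t) (hst : s ≠ t) : C.dir v t = C.dir s v := by
  have h := flagDir_eq_neg hcard hsum (show C.IsFlag v (.inl s) from hs.symm)
    (show C.IsFlag v (.inl t) from ht) fun h => hst (Sum.inl_injective h)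
  exact h.trans (hd v s hs.symm).symm

/-- The map from deformations of `C` to those of the straightened graph. -/
def straightenDeformation (hd : ∀ a b, C.graph.Adj a b → C.dir b a = - C.dir a b)
    (hcard : (C.flags v).card = 2) (hsum : ∑ f ∈ C.flags v, C.flagDir v f = 0) :
    C.deformations →ₗ[ℤ] (C.straighten v w hvw).deformations where
  toFun x := ⟨(fun s => x.1.1 s.1, fun s t => if C.graph.Adj s.1 t.1 then x.1.2 s.1 t.1
    else if (C.straighten v w hvw).graph.Adj s t then x.1.2 s.1 v + x.1.2 v t.1 else 0), by
      obtain ⟨⟨p, l⟩, h₁, h₂, h₃⟩ := x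
      simp only at h₁ h₂ h₃
      refine ⟨fun s t => ?_, fun s t h => ?_, fun s t h k => ?_⟩
      · simp only [C.graph.adj_comm t.1 s.1, (C.straighten v w hvw).graph.adj_comm t s, h₁ t.1 s.1,
          h₁ t.1 v, h₁ v s.1, add_comm (l v t.1)]
      · have h' : ¬ C.graph.Adj s.1 t.1 := fun h' => h ((C.straighten_adj v w hvw s t).mpr
          ⟨fun h'' => C.graph.irrefl (h'' ▸ h' : C.graph.Adj t.1 t.1), Or.inl h'⟩)
        simp [h, h']
      · by_cases h' : C.graph.Adj s.1 t.1
        · simp only [straighten, h', if_true]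
          exact h₃ _ _ h' k
        · simp only [h, h', if_true, if_false]
          obtain ⟨hst, h''⟩ := (C.straighten_adj v w hvw s t).mp h
          obtain ⟨hs, ht⟩ := h''.resolve_left h'
          simp only [straighten, h', if_false]
          rw [h₃ _ _ ht k, h₃ _ _ hs k,
            dir_eq_of_path hd hcard hsum hs ht fun h => hst (Subtype.ext h)]
          ring⟩
  map_add' x y := by
    refine Subtype.ext (Prod.ext rfl ?_)
    funext s t
    simp only [Submodule.coe_add, Prod.snd_add, Pi.add_apply]
    split_ifs
    · rfl
    · ring
    · simp
  map_smul' c x := by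
    refine Subtype.ext (Prod.ext rfl ?_)
    funext s t
    simp only [Submodule.coe_smul, Prod.smul_snd, Pi.smul_apply, smul_eq_mul, RingHom.id_apply]
    split_ifs
    · rfl
    · ring
    · simp

/-- If the length of `vw` and the total length of a merged edge vanish, so does the length of the
other edge at `v`; the position of `v` is then that of `w`. -/
theorem straightenDeformation_injective (hT : C.graph.IsTree)
    (hd : ∀ a b, C.graph.Adj a b → C.dir b a = - C.dir a b)
    (hcard : (C.flags v).card = 2) (hsum : ∑ f ∈ C.flags v, C.flagDir v f = 0) :
    Function.Injective
      ((straightenDeformation hvw hd hcard hsum).prod (C.edgeLength v w)) := by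
  rw [← LinearMap.ker_eq_bot, LinearMap.ker_eq_bot']
  rintro ⟨⟨p, l⟩, h₁, h₂, h₃⟩ hx
  obtain ⟨hx₁, hx₂⟩ := Prod.ext_iff.mp hx
  have hp : ∀ s : {u : C.V // u ≠ v}, p s.1 = 0 := fun s =>
    congrFun (congrArg (fun y => y.1.1) hx₁) s
  have hl : ∀ s t : {u : C.V // u ≠ v}, (if C.graph.Adj s.1 t.1 then l s.1 t.1
      else if (C.straighten v w hvw).graph.Adj s t then l s.1 v + l v t.1 else 0) = 0 :=
    fun s t => congrFun (congrFun (congrArg (fun y => y.1.2) hx₁) s) t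
  have hz : l v w = 0 := hx₂
  simp only at h₁ h₂ h₃
  have hlv : ∀ t, l v t = 0 := by
    intro t
    by_cases ht : C.graph.Adj v t
    · by_cases htw : t = w
      · rw [htw, hz]
      · have h := hl ⟨w, hvw.ne'⟩ ⟨t, ht.ne'⟩
        rw [if_neg (not_adj_of_path hT hvw.symm ht fun h => htw h.symm), if_pos, h₁ w v, hz,
          zero_add] at h
        · exact h
        · exact (C.straighten_adj v w hvw _ _).mpr
            ⟨fun h => htw (Subtype.ext_iff.mp h).symm, Or.inr ⟨hvw.symm, ht⟩⟩
    · exact h₂ _ _ ht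
  refine Subtype.ext (Prod.ext ?_ ?_)
  · funext s
    by_cases hs : s = v
    · subst hs
      funext k
      have := h₃ w s hvw.symm k
      rw [h₁ w s, hlv w, zero_mul, add_zero, hp ⟨w, hvw.ne'⟩] at this
      exact this
    · exact hp ⟨s, hs⟩
  · funext s t
    change l s t = 0
    by_cases hs : s = v
    · rw [hs]
      exact hlv t
    · by_cases ht : t = v
      · rw [ht, h₁]
        exact hlv s
      · by_cases hst : C.graph.Adj s t
        · have h := hl ⟨s, hs⟩ ⟨t, ht⟩
          rwa [if_pos hst] at h
        · exact h₂ _ _ hst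

theorem straightenDeformation_surjective (hT : C.graph.IsTree)
    (hd : ∀ a b, C.graph.Adj a b → C.dir b a = - C.dir a b)
    (hcard : (C.flags v).card = 2) (hsum : ∑ f ∈ C.flags v, C.flagDir v f = 0) :
    Function.Surjective
      ((straightenDeformation hvw hd hcard hsum).prod (C.edgeLength v w)) := by
  rintro ⟨⟨⟨p, l⟩, h₁, h₂, h₃⟩, z⟩
  simp only at h₁ h₂ h₃
  let w' : (C.straighten v w hvw).V := ⟨w, hvw.ne'⟩
  have h_unique : ∀ t, C.graph.Adj v t → ∀ s, C.graph.Adj v s → s ≠ w → t ≠ w → s = t := by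
    intro t ht s hs hsw htw
    rcases eq_or_eq_of_card_flags hcard (show C.IsFlag v (.inl w) from hvw)
      (show C.IsFlag v (.inl s) from hs) (show C.IsFlag v (.inl t) from ht)
      (fun h => hsw (Sum.inl_injective h).symm) with h | h
    · exact absurd (Sum.inl_injective h) htw
    · exact (Sum.inl_injective h).symm
  -- lengths of the edges at `v`
  let m : C.V → ℤ := fun t => if h : t = v then 0 else
    if t = w then z else if C.graph.Adj v t then l w' ⟨t, h⟩ - z else 0
  have hmw : m w = z := by simp [m, hvw.ne']
  have hm : ∀ t (h : t ≠ v), C.graph.Adj v t → t ≠ w → m t = l w' ⟨t, h⟩ - z := by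
    intro t h h' h''
    simp [m, h, h', h'']
  have hm₀ : ∀ t, ¬ C.graph.Adj v t → m t = 0 := by
    intro t h
    have htw : t ≠ w := fun h' => h (h' ▸ hvw)
    simp [m, h, htw]
  -- The vertex `v` is put back at lattice distance `z` from `w`; the remaining length `l - z` goes
  -- to the other bounded edge at `v`, if there is one.
  let P : C.V → Fin 2 → ℤ := fun t => if h : t = v then p w' + z • C.dir w v else p ⟨t, h⟩
  let L : C.V → C.V → ℤ := fun s t => if hs : s = v then m t else if ht : t = v then m s else
    if C.graph.Adj s t then l ⟨s, hs⟩ ⟨t, ht⟩ else 0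
  have hPv : ∀ k, P v k = p w' k + z * C.dir w v k := by intro k; simp [P]
  have hP : ∀ t : (C.straighten v w hvw).V, P t.1 = p t := fun t => dif_neg t.2
  have hLv : ∀ t, L v t = m t := fun t => dif_pos rfl
  have hLv' : ∀ t, L t v = m t := by
    intro t
    by_cases h : t = v
    · rw [h, hLv]
    · simp [L, h]
  have hL : ∀ s t : (C.straighten v w hvw).V, L s.1 t.1 = if C.graph.Adj s.1 t.1 then l s t else 0 := by
    intro s t
    have hs : s.1 ≠ v := s.2
    have ht : t.1 ≠ v := t.2
    simp only [L, hs, ht, dif_neg, not_false_eq_true]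
    rfl
  have hLsymm : ∀ s t : (C.straighten v w hvw).V, L s.1 t.1 = L t.1 s.1 := by
    intro s t
    rw [hL, hL, h₁ t s, C.graph.adj_comm]
  have hpos : ∀ t, C.graph.Adj v t → ∀ k, P t k = P v k + m t * C.dir v t k := by
    intro t ht k
    rw [hPv, hP ⟨t, ht.ne'⟩]
    by_cases htw : t = w
    · subst htw
      rw [hmw, hd v t hvw]
      simp [w']
    · have hnot := not_adj_of_path hT hvw.symm ht fun h => htw h.symm
      have hadj : (C.straighten v w hvw).graph.Adj w' ⟨t, ht.ne'⟩ :=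
        (C.straighten_adj v w hvw _ _).mpr
          ⟨fun h => htw (Subtype.ext_iff.mp h).symm, Or.inr ⟨hvw.symm, ht⟩⟩
      rw [h₃ w' ⟨t, ht.ne'⟩ hadj k, hm t ht.ne' ht htw,
        dir_eq_of_path hd hcard hsum hvw.symm ht fun h => htw h.symm]
      have : (C.straighten v w hvw).dir w' ⟨t, ht.ne'⟩ = C.dir w v := if_neg hnot
      rw [this]
      ring
  refine ⟨⟨(P, L), fun s t => ?_, fun s t h => ?_, fun s t h k => ?_⟩, ?_⟩
  · change L s t = L t s
    by_cases hs : s = v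
    · rw [hs, hLv, hLv']
    · by_cases ht : t = v
      · rw [ht, hLv, hLv']
      · exact hLsymm ⟨s, hs⟩ ⟨t, ht⟩
  · change L s t = 0
    by_cases hs : s = v
    · subst hs
      rw [hLv, hm₀ t h]
    · by_cases ht : t = v
      · subst ht
        rw [hLv', hm₀ s fun h' => h h'.symm]
      · rw [hL ⟨s, hs⟩ ⟨t, ht⟩, if_neg h]
  · change P t k = P s k + L s t * C.dir s t k
    by_cases hs : s = v
    · subst hs
      rw [hLv]
      exact hpos t h k
    · by_cases ht : t = v
      · subst ht
        rw [hLv', hpos s h.symm k, hd t s h.symm]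
        simp
      · have hadj : (C.straighten v w hvw).graph.Adj ⟨s, hs⟩ ⟨t, ht⟩ :=
          (C.straighten_adj v w hvw _ _).mpr ⟨fun h' => h.ne (Subtype.ext_iff.mp h'), Or.inl h⟩
        have hdir : (C.straighten v w hvw).dir ⟨s, hs⟩ ⟨t, ht⟩ = C.dir s t := if_pos h
        rw [hL ⟨s, hs⟩ ⟨t, ht⟩, hP ⟨s, hs⟩, hP ⟨t, ht⟩, if_pos h, h₃ _ _ hadj k, hdir]
  · refine Prod.ext (Subtype.ext (Prod.ext ?_ ?_)) ?_
    · funext s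
      exact hP s
    · funext s t
      change (if C.graph.Adj s.1 t.1 then L s.1 t.1
        else if (C.straighten v w hvw).graph.Adj s t then L s.1 v + L v t.1 else 0) = l s t
      split_ifs with h h'
      · rw [hL, if_pos h]
      · rw [hLv, hLv']
        obtain ⟨hst, h''⟩ := (C.straighten_adj v w hvw s t).mp h'
        obtain ⟨hs, ht⟩ := h''.resolve_left h
        by_cases hsw : s.1 = w
        · have htw : t.1 ≠ w := fun h => hst (Subtype.ext (hsw.trans h.symm))
          have hsw' : s = w' := Subtype.ext hsw
          rw [hsw, hmw, hm t.1 t.2 ht htw, hsw']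
          exact add_sub_cancel _ _
        · by_cases htw : t.1 = w
          · have htw' : t = w' := Subtype.ext htw
            rw [htw, hmw, hm s.1 s.2 hs.symm hsw, htw', h₁]
            exact sub_add_cancel _ _
          · exact absurd (h_unique _ ht _ hs.symm hsw htw) fun h => hst (Subtype.ext h)
      · exact (h₂ s t h').symm
    · exact (hLv w).trans hmw

/-- Straightening a `2`-valent vertex splits off the length of a bounded edge at this vertex. -/
def straightenEquiv (hT : C.graph.IsTree)
    (hd : ∀ a b, C.graph.Adj a b → C.dir b a = - C.dir a b)
    (hcard : (C.flags v).card = 2) (hsum : ∑ f ∈ C.flags v, C.flagDir v f = 0) :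
    C.deformations ≃ₗ[ℤ] (C.straighten v w hvw).deformations × ℤ :=
  LinearEquiv.ofBijective ((straightenDeformation hvw hd hcard hsum).prod (C.edgeLength v w))
    ⟨straightenDeformation_injective hvw hT hd hcard hsum,
      straightenDeformation_surjective hvw hT hd hcard hsum⟩

end StraightenDeformations

end MarkedGraph

namespace MarkedGraph

variable {ι : Type}

/-! ### Forgetting a marking of a trivalent tree -/

theorem card_flags_drop [Fintype ι] (C : MarkedGraph ι) (x : ι) (v : C.V) :
    ((C.drop x).flags v).card = ((C.flags v).erase (.inr (.inr x))).card := by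
  refine Finset.card_bij (fun f _ => Sum.map id (Sum.map id Subtype.val) f) ?_ ?_ ?_
  · rintro (s | e | i) hf <;> replace hf := ((C.drop x).mem_flags v _).mp hf <;>
      rw [Finset.mem_erase, mem_flags]
    · exact ⟨Sum.inl_ne_inr, hf⟩
    · exact ⟨fun h => Sum.inl_ne_inr (Sum.inr_injective h), hf⟩
    · exact ⟨fun h => i.2 (Sum.inr_injective (Sum.inr_injective h)), hf⟩
  · intro f _ g _ h
    exact (Sum.map_injective.mpr ⟨Function.injective_id, Sum.map_injective.mpr
      ⟨Function.injective_id, Subtype.val_injective⟩⟩) h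
  · rintro (s | e | i) hf <;> rw [Finset.mem_erase, mem_flags] at hf
    · exact ⟨.inl s, ((C.drop x).mem_flags v _).mpr hf.2, rfl⟩
    · exact ⟨.inr (.inl e), ((C.drop x).mem_flags v _).mpr hf.2, rfl⟩
    · exact ⟨.inr (.inr ⟨i, fun h => hf.1 (by rw [h])⟩), ((C.drop x).mem_flags v _).mpr hf.2, rfl⟩

theorem sum_flagDir_drop [Fintype ι] (C : MarkedGraph ι) (x : ι) (v : C.V) :
    ∑ f ∈ (C.drop x).flags v, (C.drop x).flagDir v f = ∑ f ∈ C.flags v, C.flagDir v f := by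
  exact ((C.drop x).sum_flagDir v).trans (C.sum_flagDir v).symm

theorem card_flags_drop_mark [Fintype ι] {C : MarkedGraph ι} (hC : C.IsTrivalent) (x : ι) :
    ((C.drop x).flags (C.mark x)).card = 2 := by
  rw [card_flags_drop, Finset.card_erase_of_mem, hC.card_flags]
  rw [mem_flags]
  exact rfl

theorem card_flags_drop_of_ne [Fintype ι] {C : MarkedGraph ι} (hC : C.IsTrivalent) (x : ι) {v : C.V}
    (h : v ≠ C.mark x) : ((C.drop x).flags v).card = 3 := by
  rw [card_flags_drop, Finset.erase_eq_of_notMem, hC.card_flags]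
  rw [mem_flags]
  exact fun h' => h (Eq.symm h')

/-- Forgetting a marking of a trivalent tree straightens its vertex. -/
theorem exists_forget_eq [Fintype ι] {C : MarkedGraph ι} (hC : C.IsTrivalent) (x : ι)
    (hV : 1 < Fintype.card C.V) :
    ∃ (w : C.V) (h : C.graph.Adj (C.mark x) w),
      C.forget x = (C.drop x).straighten (C.mark x) w h := by
  have : Nontrivial C.V := Fintype.one_lt_card_iff_nontrivial.mp hV
  have h₁ : ∃ w, (C.drop x).graph.Adj (C.mark x) w := by
    have := hC.isTree.connected.preconnected.degree_pos_of_nontrivial (C.mark x)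
    exact (C.graph.degree_pos_iff_exists_adj _).mp this
  have h : (C.drop x).valence (C.mark x) = 2 ∧ ∃ w, (C.drop x).graph.Adj (C.mark x) w :=
    ⟨((C.drop x).card_flags _).symm.trans (card_flags_drop_mark hC x), h₁⟩
  exact ⟨h.2.choose, h.2.choose_spec, by rw [forget, dif_pos h]⟩

theorem straighten_drop_isTrivalent [Fintype ι] {C : MarkedGraph ι} (hC : C.IsTrivalent) (x : ι)
    {w : C.V} (h : C.graph.Adj (C.mark x) w) :
    ((C.drop x).straighten (C.mark x) w h).IsTrivalent := by
  have hcard := card_flags_drop_mark hC x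
  have hsum := (C.sum_flagDir_drop x (C.mark x)).trans (hC.sum_flagDir _)
  have key := exists_flags_straighten (C := C.drop x) (v := C.mark x) h hC.isTree hC.dir_symm hcard hsum
  refine isTrivalent_of_flags (straighten_isTree (C := C.drop x) h hC.isTree
    fun s t hs ht hst => ?_) (fun s t hst => ?_) (fun u => ?_) (fun u => ?_)
  · by_contra! hne
    rcases eq_or_eq_of_card_flags hcard (show (C.drop x).IsFlag _ (.inl w) from h)
      (show (C.drop x).IsFlag _ (.inl s) from hs) (show (C.drop x).IsFlag _ (.inl t) from ht)
      (fun h => hne.1 (Sum.inl_injective h).symm) with h' | h'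
    · exact hne.2 (Sum.inl_injective h')
    · exact hst (Sum.inl_injective h').symm
  · obtain ⟨hst', h'⟩ := ((C.drop x).straighten_adj (C.mark x) w h s t).mp hst
    by_cases h'' : C.graph.Adj s.1 t.1
    · refine (if_pos h''.symm).trans ((hC.dir_symm _ _ h'').trans ?_)
      exact congrArg Neg.neg (if_pos h'').symm
    · obtain ⟨hs, ht⟩ := h'.resolve_left h''
      have hdir := dir_eq_of_path (C := C.drop x) hC.dir_symm hcard hsum hs ht
        fun h => hst' (Subtype.ext h)
      refine (if_neg fun h => h'' (SimpleGraph.Adj.symm h)).trans ?_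
      refine (hC.dir_symm _ _ ht).trans (congrArg Neg.neg (Eq.trans ?_ (if_neg h'').symm))
      exact hdir
  · obtain ⟨φ, hφ, -⟩ := key u
    rw [card_flags_eq_of_bijOn hφ, card_flags_drop_of_ne hC x u.2]
  · obtain ⟨φ, hφ, hdir⟩ := key u
    rw [sum_flagDir_eq_of_bijOn hφ hdir]
    exact (C.sum_flagDir_drop x u.1).trans (hC.sum_flagDir _)

theorem forget_isTrivalent [Fintype ι] {C : MarkedGraph ι} (hC : C.IsTrivalent) (x : ι)
    (hV : 1 < Fintype.card C.V) : (C.forget x).IsTrivalent := by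
  obtain ⟨w, h, heq⟩ := exists_forget_eq hC x hV
  rw [heq]
  exact straighten_drop_isTrivalent hC x h

theorem card_V_forget [Fintype ι] {C : MarkedGraph ι} (hC : C.IsTrivalent) (x : ι)
    (hV : 1 < Fintype.card C.V) : Fintype.card (C.forget x).V + 1 = Fintype.card C.V := by
  obtain ⟨w, h, heq⟩ := exists_forget_eq hC x hV
  rw [heq]
  exact straighten_card_V (C := C.drop x) h

/-- A marking at the vertex of `x` would be moved to another vertex, where the directions may
differ; hence `hi`. -/
theorem edgeDir_forget [Fintype ι] {C : MarkedGraph ι} (hC : C.IsTrivalent) (x : ι)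
    (hV : 1 < Fintype.card C.V) (i : {i // i ≠ x}) (hi : C.mark i ≠ C.mark x) :
    (C.forget x).edgeDir i = C.edgeDir i := by
  obtain ⟨w, h, heq⟩ := exists_forget_eq hC x hV
  rw [heq]
  have hcard := card_flags_drop_mark hC x
  have hsum := (C.sum_flagDir_drop x (C.mark x)).trans (hC.sum_flagDir _)
  have hmark : ((C.drop x).straighten (C.mark x) w h).mark i = ⟨C.mark i, hi⟩ := dif_neg hi
  refine edgeDir_congr C _ i.1 i fun u hu => ?_
  rw [hmark]
  obtain ⟨φ, hφ, hdir⟩ := exists_flags_straighten (C := C.drop x) (v := C.mark x) h hC.isTree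
    hC.dir_symm hcard hsum ⟨C.mark i, hi⟩
  exact isFlagDir_iff_of_bijOn hφ hdir hu

/-- Two markings leave a single further flag at the 3-valent vertex, and balancing forces its
direction to be 0. -/
theorem edgeDir_eq_zero_of_mark_eq [Fintype ι] {C : MarkedGraph ι} (hC : C.IsTrivalent) {x i : ι}
    (hix : i ≠ x) (hi : C.mark i = C.mark x) : C.edgeDir x = 0 := by
  have hcard := card_flags_drop_mark hC x
  have hsum := (C.sum_flagDir_drop x (C.mark x)).trans (hC.sum_flagDir _)
  have hi' : (C.drop x).IsFlag (C.mark x) (.inr (.inr ⟨i, hix⟩)) := hi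
  have h₀ : ∀ g, (C.drop x).IsFlag (C.mark x) g → (C.drop x).flagDir (C.mark x) g = 0 := by
    intro g hg
    by_cases h : Sum.inr (Sum.inr ⟨i, hix⟩) = g
    · rw [← h]
      rfl
    · rw [flagDir_eq_neg hcard hsum hi' hg h]
      exact neg_zero
  unfold edgeDir
  rw [dif_neg]
  rintro ⟨u, hu, hu'⟩
  obtain ⟨g, hg, hgu⟩ := ((C.drop x).isFlagDir_iff (C.mark x) hu).mp hu'
  exact hu (hgu.symm.trans (h₀ g hg))

/-- The deformations of a trivalent tree are those of the tree with one marking `x` forgotten, together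
with a movement of the marking along its edge. -/
theorem exists_forget_equiv [Fintype ι] {C : MarkedGraph ι} (hC : C.IsTrivalent) (x : ι)
    (hV : 1 < Fintype.card C.V) :
    ∃ (e : C.deformations ≃ₗ[ℤ] (C.forget x).deformations × ℤ) (w : (C.forget x).V)
      (u : Fin 2 → ℤ), (C.edgeDir x = u ∨ C.edgeDir x = -u) ∧
      (∀ (i : {i // i ≠ x}) (k : Fin 2) (y : C.deformations),
        C.position (C.mark i) k y = (C.forget x).position ((C.forget x).mark i) k (e y).1) ∧
      ∀ (k : Fin 2) (y : C.deformations),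
        C.position (C.mark x) k y = (C.forget x).position w k (e y).1 + (e y).2 * u k := by
  obtain ⟨w, h, heq⟩ := exists_forget_eq hC x hV
  rw [heq]
  have hcard := card_flags_drop_mark hC x
  have hsum := (C.sum_flagDir_drop x (C.mark x)).trans (hC.sum_flagDir _)
  have hw : (C.drop x).IsFlag (C.mark x) (.inl w) := h
  have hpos : ∀ (k : Fin 2) (y : C.deformations),
      C.position (C.mark x) k y = C.position w k y + y.1.2 (C.mark x) w * C.dir w (C.mark x) k := by
    intro k y
    obtain ⟨h₁, -, h₃⟩ := y.2
    rw [h₁]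
    exact h₃ w (C.mark x) h.symm k
  refine ⟨straightenEquiv (C := C.drop x) h hC.isTree hC.dir_symm hcard hsum, ⟨w, h.ne'⟩,
    C.dir w (C.mark x), ?_, fun i k y => ?_, fun k y => ?_⟩
  · rw [hC.dir_symm _ _ h]
    have key : C.edgeDir x = C.dir (C.mark x) w ∨ C.edgeDir x = - C.dir (C.mark x) w := by
      refine C.edgeDir_eq_or_eq_neg x _ (fun _ => Or.inl ⟨w, h, rfl⟩) fun f hf => ?_
      by_cases hfx : f = .inr (.inr x)
      · left
        rw [hfx]
        rfl
      · right
        obtain ⟨g, hg, hgf⟩ : ∃ g, (C.drop x).IsFlag (C.mark x) g ∧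
            (C.drop x).flagDir (C.mark x) g = C.flagDir (C.mark x) f := by
          rcases f with s | e | i
          · exact ⟨.inl s, hf, rfl⟩
          · exact ⟨.inr (.inl e), hf, rfl⟩
          · exact ⟨.inr (.inr ⟨i, fun h => hfx (by rw [h])⟩), hf, rfl⟩
        rw [← hgf]
        by_cases hgw : Sum.inl w = g
        · rw [← hgw]
          exact Or.inl rfl
        · exact Or.inr (flagDir_eq_neg hcard hsum hw hg hgw)
    rw [neg_neg]
    exact key.symm
  -- If `i` shares the vertex of `x`, straightening moves it to `w`. The edge in between is
  -- contracted by balancing, so the image point is unchanged.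
  · by_cases hi : C.mark i = C.mark x
    · have hmark : ((C.drop x).straighten (C.mark x) w h).mark i = ⟨w, h.ne'⟩ := dif_pos hi
      have hdir : C.dir w (C.mark x) = 0 := by
        have hi' : (C.drop x).IsFlag (C.mark x) (.inr (.inr i)) := hi
        have := flagDir_eq_neg hcard hsum hi' hw Sum.inr_ne_inl
        rw [hC.dir_symm _ _ h]
        exact (congrArg Neg.neg this).trans (by rw [neg_neg]; rfl)
      rw [hmark, hi, hpos, hdir]
      simp only [Pi.zero_apply, mul_zero, add_zero]
      rfl
    · have hmark : ((C.drop x).straighten (C.mark x) w h).mark i = ⟨C.mark i, hi⟩ := dif_neg hi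
      rw [hmark]
      rfl
  · exact hpos k y

/-! ### The parts of a tree cut at a contracted edge -/

theorem side_connected (C : MarkedGraph ι) (a b : C.V) : (C.side a b).graph.Connected := by
  have key : ∀ v w, (C.graph.deleteEdges {s(a, b)}).Reachable v w → ∀ (hv : C.OnSide a b v)
      (hw : C.OnSide a b w), (C.side a b).graph.Reachable ⟨v, hv⟩ ⟨w, hw⟩ := by
    rintro v w ⟨p⟩
    induction p with
    | nil => exact fun _ _ => SimpleGraph.Reachable.refl _
    | @cons v u w h p ih =>
      intro hv hw
      have hu : C.OnSide a b u := SimpleGraph.Reachable.trans hv h.reachable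
      refine SimpleGraph.Reachable.trans (SimpleGraph.Adj.reachable ?_) (ih hu hw)
      exact (SimpleGraph.deleteEdges_adj.mp h).1
  exact { preconnected := fun v w => key v.1 w.1 (SimpleGraph.Reachable.trans v.2.symm w.2) v.2 w.2
          nonempty := ⟨⟨a, C.onSide_left a b⟩⟩ }

theorem side_isTree {C : MarkedGraph ι} (hC : C.graph.IsTree) (a b : C.V) :
    (C.side a b).graph.IsTree :=
  ⟨C.side_connected a b, hC.isAcyclic.induce _⟩

/-- The new marking `none` takes the place of the flag from `a` to `b`. Both have direction 0 since
the edge is contracted, so valence and balancing survive the cut. -/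
theorem exists_flags_side {C : MarkedGraph ι} (hT : C.graph.IsTree) {a b : C.V}
    (hab : C.graph.Adj a b) (h₀ : C.dir a b = 0) (u : (C.side a b).V) :
    ∃ φ : (C.side a b).V ⊕ (C.side a b).ends ⊕ Option {i : ι // C.OnSide a b (C.mark i)} →
        C.V ⊕ C.ends ⊕ ι,
      Set.BijOn φ {f | (C.side a b).IsFlag u f} {f | C.IsFlag u.1 f} ∧
      ∀ f, (C.side a b).IsFlag u f → (C.side a b).flagDir u f = C.flagDir u.1 (φ f) := by
  have hb : ¬ C.OnSide a b b := not_onSide_right hT hab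
  refine ⟨fun f => match f with
    | .inl s => .inl s.1
    | .inr (.inl e) => .inr (.inl e.1)
    | .inr (.inr none) => .inl b
    | .inr (.inr (some i)) => .inr (.inr i.1), ⟨?_, ?_, ?_⟩, ?_⟩
  · rintro (s | e | _ | i) hf
    · exact hf
    · exact congrArg Subtype.val (show (C.side a b).endAt e = u from hf)
    · have : a = u.1 := congrArg Subtype.val (show (C.side a b).mark none = u from hf)
      exact this ▸ hab
    · exact congrArg Subtype.val (show (C.side a b).mark (some i) = u from hf)
  · rintro (s | e | _ | i) hf (t | e' | _ | j) hg h <;>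
      simp only [Sum.inl.injEq, Sum.inr.injEq, reduceCtorEq] at h
    · rw [Subtype.ext h]
    · have hs : C.OnSide a b s.1 := s.2
      rw [h] at hs
      exact absurd hs hb
    · rw [Subtype.ext h]
    · have ht : C.OnSide a b t.1 := t.2
      rw [← h] at ht
      exact absurd ht hb
    · rfl
    · rw [Subtype.ext h]
  · rintro (s | e | i) hf
    · by_cases hs : C.OnSide a b s
      · exact ⟨.inl ⟨s, hs⟩, hf, rfl⟩
      · have hus : s(u.1, s) = s(a, b) := by
          by_contra hne
          exact hs ((C.onSide_iff_of_adj a b hf hne).mp u.2)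
        rcases Sym2.eq_iff.mp hus with ⟨h, rfl⟩ | ⟨h, -⟩
        · exact ⟨.inr (.inr none), Subtype.ext h.symm, rfl⟩
        · have hu : C.OnSide a b u.1 := u.2
          rw [h] at hu
          exact absurd hu hb
    · have he : C.OnSide a b (C.endAt e) := (show C.endAt e = u.1 from hf) ▸ u.2
      exact ⟨.inr (.inl ⟨e, he⟩), Subtype.ext hf, rfl⟩
    · have hi : C.OnSide a b (C.mark i) := (show C.mark i = u.1 from hf) ▸ u.2
      exact ⟨.inr (.inr (some ⟨i, hi⟩)), Subtype.ext hf, rfl⟩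
  · rintro (s | e | _ | i) hf
    · rfl
    · rfl
    · have : a = u.1 := congrArg Subtype.val (show (C.side a b).mark none = u from hf)
      exact (this ▸ h₀ : C.dir u.1 b = 0).symm
    · rfl

theorem side_isTrivalent [Fintype ι] {C : MarkedGraph ι} (hC : C.IsTrivalent) {a b : C.V}
    (hab : C.graph.Adj a b) (h₀ : C.dir a b = 0) : (C.side a b).IsTrivalent := by
  refine isTrivalent_of_flags (side_isTree hC.isTree a b) (fun s t h => hC.dir_symm _ _ h)
    (fun u => ?_) (fun u => ?_)
  · obtain ⟨φ, hφ, -⟩ := exists_flags_side hC.isTree hab h₀ u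
    rw [card_flags_eq_of_bijOn hφ, hC.card_flags]
  · obtain ⟨φ, hφ, hdir⟩ := exists_flags_side hC.isTree hab h₀ u
    rw [sum_flagDir_eq_of_bijOn hφ hdir, hC.sum_flagDir]

/-- Restriction of deformations to the part on one side of an edge. -/
def restrict (C : MarkedGraph ι) (a b : C.V) : C.deformations →ₗ[ℤ] (C.side a b).deformations where
  toFun x := ⟨(fun s => x.1.1 s.1, fun s t => x.1.2 s.1 t.1),
    fun s t => x.2.1 s.1 t.1, fun s t h => x.2.2.1 s.1 t.1 h, fun s t h k => x.2.2.2 s.1 t.1 h k⟩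
  map_add' _ _ := rfl
  map_smul' _ _ := rfl

/-- Translations, as deformations. -/
def translation (C : MarkedGraph ι) : (Fin 2 → ℤ) →ₗ[ℤ] C.deformations where
  toFun z := ⟨(fun _ => z, fun _ _ => 0), by simp [deformations]⟩
  map_add' _ _ := Subtype.ext (Prod.ext rfl (by funext s t; simp))
  map_smul' _ _ := Subtype.ext (Prod.ext rfl (by funext s t; simp))

/-- Cutting a deformation at the edge `ab`, and translating the part on the side of `b`. -/
def cut (C : MarkedGraph ι) (a b : C.V) :
    (Fin 2 → ℤ) × C.deformations →ₗ[ℤ]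
      ((C.side a b).deformations × (C.side b a).deformations) × ℤ :=
  (((C.restrict a b).comp (LinearMap.snd ℤ _ _)).prod
    ((C.restrict b a).comp (LinearMap.snd ℤ _ _) +
      (C.side b a).translation.comp (LinearMap.fst ℤ _ _))).prod
    ((C.edgeLength a b).comp (LinearMap.snd ℤ _ _))

theorem cut_injective {C : MarkedGraph ι} (hT : C.graph.IsTree) {a b : C.V}
    (hab : C.graph.Adj a b) (h₀ : C.dir a b = 0) : Function.Injective (C.cut a b) := by
  rw [← LinearMap.ker_eq_bot, LinearMap.ker_eq_bot']
  rintro ⟨z, ⟨⟨p, l⟩, h₁, h₂, h₃⟩⟩ hx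
  obtain ⟨hx', hx₃⟩ := Prod.ext_iff.mp hx
  obtain ⟨hx₁, hx₂⟩ := Prod.ext_iff.mp hx'
  simp only at h₁ h₂ h₃
  have hp₁ : ∀ s, C.OnSide a b s → p s = 0 := fun s hs =>
    congrFun (congrArg (fun y => y.1.1) hx₁) ⟨s, hs⟩
  have hl₁ : ∀ s t, C.OnSide a b s → C.OnSide a b t → l s t = 0 := fun s t hs ht =>
    congrFun (congrFun (congrArg (fun y => y.1.2) hx₁) ⟨s, hs⟩) ⟨t, ht⟩
  have hp₂ : ∀ s, C.OnSide b a s → p s + z = 0 := fun s hs =>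
    congrFun (congrArg (fun y => y.1.1) hx₂) ⟨s, hs⟩
  have hl₂ : ∀ s t, C.OnSide b a s → C.OnSide b a t → l s t = 0 := fun s t hs ht =>
    (add_zero _).symm.trans (congrFun (congrFun (congrArg (fun y => y.1.2) hx₂) ⟨s, hs⟩) ⟨t, ht⟩)
  have hl : l a b = 0 := hx₃
  -- The contracted edge forces `a` and `b` to the same point, so the vanishing of the first part
  -- pins down the second one and its translation.
  have hpb : p b = 0 := by
    funext k
    rw [h₃ a b hab k, hl, hp₁ a (C.onSide_left a b)]
    simp
  have hz : z = 0 := by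
    have := hp₂ b (C.onSide_left b a)
    rwa [hpb, zero_add] at this
  have hlab : ∀ s t, C.OnSide a b s → C.OnSide b a t → l s t = 0 := by
    intro s t hs ht
    by_cases hst : C.graph.Adj s t
    · by_cases he : s(s, t) = s(a, b)
      · rcases Sym2.eq_iff.mp he with ⟨rfl, rfl⟩ | ⟨rfl, rfl⟩
        · exact hl
        · rw [h₁, hl]
      · exact (onSide_symm_disjoint hT hab ((C.onSide_iff_of_adj a b hst he).mp hs) ht).elim
    · exact h₂ s t hst
  refine Prod.ext hz (Subtype.ext (Prod.ext ?_ ?_))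
  · funext s
    change p s = 0
    rcases onSide_or hT hab s with hs | hs
    · exact hp₁ s hs
    · have := hp₂ s hs
      rwa [hz, add_zero] at this
  · funext s t
    change l s t = 0
    rcases onSide_or hT hab s with hs | hs <;> rcases onSide_or hT hab t with ht | ht
    · exact hl₁ s t hs ht
    · exact hlab s t hs ht
    · rw [h₁]
      exact hlab t s ht hs
    · exact hl₂ s t hs ht

theorem cut_surjective {C : MarkedGraph ι} (hT : C.graph.IsTree) {a b : C.V}
    (hd : ∀ a b, C.graph.Adj a b → C.dir b a = - C.dir a b)
    (hab : C.graph.Adj a b) (h₀ : C.dir a b = 0) : Function.Surjective (C.cut a b) := by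
  rintro ⟨⟨⟨⟨p, l⟩, h₁, h₂, h₃⟩, ⟨⟨p', l'⟩, h₁', h₂', h₃'⟩⟩, m⟩
  simp only at h₁ h₂ h₃ h₁' h₂' h₃'
  have hside : ∀ v, ¬ C.OnSide a b v → C.OnSide b a v := fun v hv =>
    (onSide_or hT hab v).resolve_left hv
  have hnot : ∀ v, C.OnSide b a v → ¬ C.OnSide a b v := fun v hv hv' =>
    onSide_symm_disjoint hT hab hv' hv
  -- The translation is the displacement from `P` to `Q`; undoing it makes the two parts fit
  -- together.
  let z : Fin 2 → ℤ := p' ⟨b, C.onSide_left b a⟩ - p ⟨a, C.onSide_left a b⟩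
  let P : C.V → Fin 2 → ℤ := fun v => if h : C.OnSide a b v then p ⟨v, h⟩ else p' ⟨v, hside v h⟩ - z
  let L : C.V → C.V → ℤ := fun s t =>
    if hs : C.OnSide a b s then
      if ht : C.OnSide a b t then l ⟨s, hs⟩ ⟨t, ht⟩ else if C.graph.Adj s t then m else 0
    else
      if ht : C.OnSide a b t then if C.graph.Adj s t then m else 0
      else l' ⟨s, hside s hs⟩ ⟨t, hside t ht⟩
  have hP : ∀ v (h : C.OnSide a b v), P v = p ⟨v, h⟩ := fun v h => dif_pos h
  have hP' : ∀ v (h : C.OnSide b a v), P v = p' ⟨v, h⟩ - z := fun v h => dif_neg (hnot v h)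
  have hL : ∀ s t (hs : C.OnSide a b s) (ht : C.OnSide a b t), L s t = l ⟨s, hs⟩ ⟨t, ht⟩ := by
    intro s t hs ht
    simp [L, hs, ht]
  have hL' : ∀ s t (hs : C.OnSide b a s) (ht : C.OnSide b a t), L s t = l' ⟨s, hs⟩ ⟨t, ht⟩ := by
    intro s t hs ht
    simp [L, hnot s hs, hnot t ht]
  have hLab : ∀ s t, C.OnSide a b s → C.OnSide b a t → L s t = if C.graph.Adj s t then m else 0 := by
    intro s t hs ht
    simp [L, hs, hnot t ht]
  have hLba : ∀ s t, C.OnSide b a s → C.OnSide a b t → L s t = if C.graph.Adj s t then m else 0 := by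
    intro s t hs ht
    simp [L, hnot s hs, ht]
  have hPab : P b = P a := by
    rw [hP a (C.onSide_left a b), hP' b (C.onSide_left b a)]
    exact sub_sub_cancel _ _
  refine ⟨(z, ⟨(P, L), fun s t => ?_, fun s t h => ?_, fun s t h k => ?_⟩), ?_⟩
  · change L s t = L t s
    rcases onSide_or hT hab s with hs | hs <;> rcases onSide_or hT hab t with ht | ht
    · rw [hL s t hs ht, hL t s ht hs]
      exact h₁ _ _
    · rw [hLab s t hs ht, hLba t s ht hs, C.graph.adj_comm]
    · rw [hLba s t hs ht, hLab t s ht hs, C.graph.adj_comm]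
    · rw [hL' s t hs ht, hL' t s ht hs]
      exact h₁' _ _
  · change L s t = 0
    rcases onSide_or hT hab s with hs | hs <;> rcases onSide_or hT hab t with ht | ht
    · rw [hL s t hs ht]
      exact h₂ _ _ h
    · rw [hLab s t hs ht, if_neg h]
    · rw [hLba s t hs ht, if_neg h]
    · rw [hL' s t hs ht]
      exact h₂' _ _ h
  · change P t k = P s k + L s t * C.dir s t k
    by_cases he : s(s, t) = s(a, b)
    · have hdir : C.dir s t = 0 := by
        rcases Sym2.eq_iff.mp he with ⟨rfl, rfl⟩ | ⟨rfl, rfl⟩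
        · exact h₀
        · rw [hd _ _ hab, h₀, neg_zero]
      have hpos : P t = P s := by
        rcases Sym2.eq_iff.mp he with ⟨rfl, rfl⟩ | ⟨rfl, rfl⟩
        · exact hPab
        · exact hPab.symm
      rw [hdir, hpos]
      simp
    · rcases onSide_or hT hab s with hs | hs
      · have ht := (C.onSide_iff_of_adj a b h he).mp hs
        rw [hP s hs, hP t ht, hL s t hs ht]
        exact h₃ ⟨s, hs⟩ ⟨t, ht⟩ h k
      · have ht := (C.onSide_iff_of_adj b a h (by rwa [Sym2.eq_swap (a := b)])).mp hs
        rw [hP' s hs, hP' t ht, hL' s t hs ht]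
        have := h₃' ⟨s, hs⟩ ⟨t, ht⟩ h k
        simp only [Pi.sub_apply]
        rw [this]
        change _ + _ * C.dir s t k - _ = _
        ring
  · refine Prod.ext (Prod.ext (Subtype.ext (Prod.ext ?_ ?_)) (Subtype.ext (Prod.ext ?_ ?_))) ?_
    · funext s
      exact hP s.1 s.2
    · funext s t
      exact hL s.1 t.1 s.2 t.2
    · funext s
      change P s.1 + z = _
      rw [hP' s.1 s.2, sub_add_cancel]
      rfl
    · funext s t
      change L s.1 t.1 + 0 = _
      rw [add_zero]
      exact hL' s.1 t.1 s.2 t.2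
    · change L a b = m
      rw [hLab a b (C.onSide_left a b) (C.onSide_left b a), if_pos hab]

/-- Cutting a tree at a contracted edge: a pair of deformations of the two parts, together with a length
of the contracted edge, is a deformation of the tree up to a translation of one of the parts. -/
def cutEquiv {C : MarkedGraph ι} (hT : C.graph.IsTree)
    (hd : ∀ a b, C.graph.Adj a b → C.dir b a = - C.dir a b) {a b : C.V}
    (hab : C.graph.Adj a b) (h₀ : C.dir a b = 0) :
    ((Fin 2 → ℤ) × C.deformations) ≃ₗ[ℤ]
      ((C.side a b).deformations × (C.side b a).deformations) × ℤ :=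
  LinearEquiv.ofBijective (C.cut a b) ⟨cut_injective hT hab h₀, cut_surjective hT hd hab h₀⟩

end MarkedGraph

theorem card_subtype_ne {α : Type} [Finite α] (x : α) :
    Nat.card {i : α // i ≠ x} + 1 = Nat.card α := by
  have := Fintype.ofFinite α
  have h₁ : Fintype.card {i : α // i ≠ x} = Fintype.card α - 1 := by
    rw [Fintype.card_subtype_compl, Fintype.card_subtype_eq]
  have h₂ : 0 < Fintype.card α := Fintype.card_pos_iff.mpr ⟨x⟩
  rw [Nat.card_eq_fintype_card, Nat.card_eq_fintype_card]
  omega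

theorem natAbs_cross_of_eq_or_eq_neg {u u' v v' : Fin 2 → ℤ} (hu : u' = u ∨ u' = -u)
    (hv : v' = v ∨ v' = -v) : (cross u' v').natAbs = (cross u v).natAbs := by
  have h : cross u' v' = cross u v ∨ cross u' v' = - cross u v := by
    rcases hu with rfl | rfl <;> rcases hv with rfl | rfl
    · exact Or.inl rfl
    · exact Or.inr (by simp only [cross, Pi.neg_apply]; ring)
    · exact Or.inr (by simp only [cross, Pi.neg_apply]; ring)
    · exact Or.inl (by simp only [cross, Pi.neg_apply]; ring)
  exact Int.natAbs_eq_natAbs_iff.mpr h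

namespace MarkedGraph

/-! ### One part of the cut tree, with the new marking and `x` forgotten -/

section Side

variable {ι : Type}

/-- The part of `C` on the side of `a`, with the new marking and the marking `x` forgotten. -/
abbrev forgetSide (C : MarkedGraph ι) (a b : C.V) (x : ι) (hx : C.OnSide a b (C.mark x)) :=
  ((C.side a b).forget none).forget ⟨some ⟨x, hx⟩, Option.some_ne_none _⟩

/-- The markings of `C` on the side of `a` other than `x`. -/
abbrev SideMarkings (C : MarkedGraph ι) (a b : C.V) (x : ι) (hx : C.OnSide a b (C.mark x)) : Type :=
  {i : {i : Option {i : ι // C.OnSide a b (C.mark i)} // i ≠ none} //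
    i ≠ ⟨some ⟨x, hx⟩, Option.some_ne_none _⟩}

/-- The markings that remain after forgetting two of them, as markings of `C`. -/
def sideMarkingsEquiv (C : MarkedGraph ι) (a b : C.V) (x : ι) (hx : C.OnSide a b (C.mark x)) :
    C.SideMarkings a b x hx ≃ {i : ι // C.OnSide a b (C.mark i) ∧ i ≠ x} where
  toFun
    | ⟨⟨some i, _⟩, h'⟩ => ⟨i.1, i.2, fun h => h' (Subtype.ext (congrArg some (Subtype.ext h)))⟩
    | ⟨⟨none, h⟩, _⟩ => absurd rfl h
  invFun i := ⟨⟨some ⟨i.1, i.2.1⟩, Option.some_ne_none _⟩, fun h =>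
    i.2.2 (Subtype.ext_iff.mp (Option.some_injective _ (Subtype.ext_iff.mp h)))⟩
  left_inv
    | ⟨⟨some _, _⟩, _⟩ => rfl
    | ⟨⟨none, h⟩, _⟩ => absurd rfl h
  right_inv _ := rfl

variable [Fintype ι] {C : MarkedGraph ι} {a b : C.V} {x : ι}

theorem card_side_V (hC : C.IsTrivalent) (hab : C.graph.Adj a b) (h₀ : C.dir a b = 0)
    (hcard : Fintype.card (C.side a b).ends = Fintype.card {i : ι // C.OnSide a b (C.mark i)}) :
    Fintype.card (C.side a b).V + 1 = 2 * Fintype.card {i : ι // C.OnSide a b (C.mark i)} := by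
  have h := card_V_of_isTrivalent (side_isTrivalent hC hab h₀)
  rw [Fintype.card_option] at h
  omega

theorem forgetSide_isTrivalent (hC : C.IsTrivalent) (hab : C.graph.Adj a b) (h₀ : C.dir a b = 0)
    (hx : C.OnSide a b (C.mark x)) (hV : 2 < Fintype.card (C.side a b).V) :
    (C.forgetSide a b x hx).IsTrivalent := by
  have h₁ := side_isTrivalent hC hab h₀
  have h₂ := card_V_forget h₁ none (by omega)
  exact forget_isTrivalent (forget_isTrivalent h₁ none (by omega)) _ (by omega)

/-- The `ev` block is square. With `N` ends and `N` original markings, the part has `2N - 1`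
vertices; forgetting two markings leaves `2N - 3`, hence rank `2N - 2`, matching two evaluations for
each of `N - 1` markings. -/
theorem card_sideMarkings (hC : C.IsTrivalent) (hab : C.graph.Adj a b) (h₀ : C.dir a b = 0)
    (hx : C.OnSide a b (C.mark x)) (hV : 2 < Fintype.card (C.side a b).V)
    (hcard : Fintype.card (C.side a b).ends = Fintype.card {i : ι // C.OnSide a b (C.mark i)}) :
    Nat.card (C.SideMarkings a b x hx × Fin 2)
      = Module.finrank ℤ (C.forgetSide a b x hx).deformations := by
  have h₁ := side_isTrivalent hC hab h₀
  have h₂ := card_V_forget h₁ none (by omega)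
  have h₃ := forget_isTrivalent h₁ none (by omega)
  have h₄ : Fintype.card (C.forgetSide a b x hx).V + 1 = _ := card_V_forget h₃ ⟨some ⟨x, hx⟩, Option.some_ne_none _⟩ (by omega)
  have h₅ := forgetSide_isTrivalent hC hab h₀ hx hV
  have h₆ := card_side_V hC hab h₀ hcard
  rw [finrank_deformations _ h₅.isTree h₅.dir_symm, Nat.card_prod,
    Nat.card_eq_fintype_card (α := Fin 2), Fintype.card_fin]
  have h₇ := card_subtype_ne (none : Option {i : ι // C.OnSide a b (C.mark i)})
  have h₈ : Nat.card (C.SideMarkings a b x hx) + 1 = _ := card_subtype_ne (⟨some ⟨x, hx⟩, Option.some_ne_none _⟩ :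
    {i : Option {i : ι // C.OnSide a b (C.mark i)} // i ≠ none})
  rw [Nat.card_eq_fintype_card (α := Option _), Fintype.card_option] at h₇
  omega

/-- The deformations of one part of a tree cut at a contracted edge, in terms of the deformations of the
part with two markings forgotten. -/
theorem exists_forgetSide_equiv (hC : C.IsTrivalent) (hab : C.graph.Adj a b) (h₀ : C.dir a b = 0)
    (hx : C.OnSide a b (C.mark x)) (hV : 2 < Fintype.card (C.side a b).V) :
    ∃ (e : (C.side a b).deformations ≃ₗ[ℤ] ((C.forgetSide a b x hx).deformations × ℤ) × ℤ)
      (α : Fin 2 → (C.forgetSide a b x hx).deformations →ₗ[ℤ] ℤ)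
      (β : Fin 2 → (C.forgetSide a b x hx).deformations × ℤ →ₗ[ℤ] ℤ) (u v : Fin 2 → ℤ),
      ((C.side a b).edgeDir none = u ∨ (C.side a b).edgeDir none = -u) ∧
      ((C.side a b).edgeDir none = 0 ∨ (C.side a b).edgeDir (some ⟨x, hx⟩) = v ∨
        (C.side a b).edgeDir (some ⟨x, hx⟩) = -v) ∧
      (∀ (j : C.SideMarkings a b x hx) (k : Fin 2) (y : (C.side a b).deformations),
        (C.side a b).position ((C.side a b).mark j.1.1) k y =
          (C.forgetSide a b x hx).position ((C.forgetSide a b x hx).mark j) k (e y).1.1) ∧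
      (∀ (k : Fin 2) (y : (C.side a b).deformations),
        (C.side a b).position ((C.side a b).mark (some ⟨x, hx⟩)) k y =
          α k (e y).1.1 + (e y).1.2 * v k) ∧
      ∀ (k : Fin 2) (y : (C.side a b).deformations),
        (C.side a b).position ((C.side a b).mark none) k y = β k (e y).1 + (e y).2 * u k := by
  have h₁ := side_isTrivalent hC hab h₀
  have h₂ := card_V_forget h₁ none (by omega)
  have h₃ := forget_isTrivalent h₁ none (by omega)
  obtain ⟨e, w, u, hu, hmark, hnone⟩ := exists_forget_equiv h₁ none (by omega)
  obtain ⟨e', w', v, hv, hmark', hx'⟩ := exists_forget_equiv h₃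
    ⟨some ⟨x, hx⟩, Option.some_ne_none _⟩ (by omega)
  refine ⟨e.trans (e'.prodCongr (LinearEquiv.refl ℤ ℤ)), (C.forgetSide a b x hx).position w',
    fun k => (((C.side a b).forget none).position w k).comp e'.symm.toLinearMap, u, v, hu, ?_,
    fun j k y => ?_, fun k y => ?_, fun k y => ?_⟩
  -- If `x` sits at the vertex of the new marking, its edge direction can change when `none` is
  -- forgotten. Then `none` has direction 0, and this alternative is recorded instead.
  · by_cases h : (C.side a b).mark (some ⟨x, hx⟩) = (C.side a b).mark none
    · exact Or.inl (edgeDir_eq_zero_of_mark_eq h₁ (Option.some_ne_none _) h)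
    · right
      rw [← edgeDir_forget h₁ none (by omega) ⟨some ⟨x, hx⟩, Option.some_ne_none _⟩ h]
      exact hv
  · exact (hmark j.1 k y).trans (hmark' j k (e y).1)
  · exact (hmark ⟨some ⟨x, hx⟩, Option.some_ne_none _⟩ k y).trans (hx' k (e y).1)
  · rw [hnone k y]
    simp

end Side

/-! ### The rows of `π̃` as linear forms on deformations -/

section PiTilde

variable {n l : ℕ}

/-- The linear form `cross u (·)` at the image of a vertex. -/
def crossPosition {ι : Type} (C : MarkedGraph ι) (u : Fin 2 → ℤ) (t : C.V) :
    C.deformations →ₗ[ℤ] ℤ :=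
  u 0 • C.position t 1 - u 1 • C.position t 0

theorem crossPosition_apply {ι : Type} (C : MarkedGraph ι) (u : Fin 2 → ℤ) (t : C.V)
    (y : C.deformations) : C.crossPosition u t y = u 0 * C.position t 1 y - u 1 * C.position t 0 y :=
  rfl

/-- The length coordinate of `M₄`, as a linear form on deformations. -/
def sepForm (C : MarkedGraph (Fin n)) (hn : 4 ≤ n) : C.deformations →ₗ[ℤ] ℤ :=
  ∑ e : C.graph.edgeSet,
    (if C.Separates e (first4 hn 0) (first4 hn 1) (first4 hn 2) (first4 hn 3) ∨
        C.Separates e (first4 hn 0) (first4 hn 2) (first4 hn 1) (first4 hn 3) ∨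
        C.Separates e (first4 hn 0) (first4 hn 3) (first4 hn 1) (first4 hn 2) then 1 else 0 : ℤ) •
      C.edgeLength (Quot.out (e : Sym2 C.V)).1 (Quot.out (e : Sym2 C.V)).2

/-- The rows of the matrix of `π̃`, as linear forms on deformations. -/
def piForm (C : MarkedGraph (Fin n)) (hn : 4 ≤ n) (L : TropicalCurve l) :
    Fin 2 ⊕ ({i : Fin n // 2 ≤ i.val} × Fin 2) ⊕ Unit → C.deformations →ₗ[ℤ] ℤ
  | .inl k => C.crossPosition (L.edgeVector (C.ev (first4 hn (Fin.castLE (by norm_num) k))))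
      (C.mark (first4 hn (Fin.castLE (by norm_num) k)))
  | .inr (.inl i) => C.position (C.mark i.1) i.2
  | .inr (.inr _) => C.sepForm hn

theorem out_adj {V : Type} {G : SimpleGraph V} (e : G.edgeSet) :
    G.Adj (Quot.out (e : Sym2 V)).1 (Quot.out (e : Sym2 V)).2 := by
  rw [← SimpleGraph.mem_edgeSet,
    show s((Quot.out (e : Sym2 V)).1, (Quot.out (e : Sym2 V)).2) = (e : Sym2 V) from Quot.out_eq _]
  exact e.2

theorem piMult_eq (C : MarkedGraph (Fin n)) (hn : 4 ≤ n) (L : TropicalCurve l)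
    (hT : C.graph.IsTree) (hd : ∀ a b, C.graph.Adj a b → C.dir b a = - C.dir a b) :
    C.piMult hn L = absDetOn (C.piForm hn L) := by
  have h := hT.connected.nonempty
  rw [piMult, dif_pos h, absDetOn_eq_basis _ (C.coordBasis hT hd h.some)]
  congr 1
  ext (k | i | i) c
  · rw [Matrix.of_apply, piForm, crossPosition_apply, position_coordBasis, position_coordBasis]
    rfl
  · exact (C.position_coordBasis hT hd _ _ _ _).symm
  · rw [Matrix.of_apply, piForm, sepForm, LinearMap.sum_apply]
    simp only [LinearMap.smul_apply, smul_eq_mul]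
    rcases c with k | e
    · simp only [edgeLength_coordBasis_inl, mul_zero, Finset.sum_const_zero]
      rfl
    · have : ∀ e' : C.graph.edgeSet,
          C.edgeLength (Quot.out (e' : Sym2 C.V)).1 (Quot.out (e' : Sym2 C.V)).2
            (C.coordBasis hT hd h.some (.inr e)) = if e' = e then 1 else 0 := by
        intro e'
        rw [edgeLength_coordBasis_inr _ _ _ _ _ _ _ (out_adj e'),
          show s((Quot.out (e' : Sym2 C.V)).1, (Quot.out (e' : Sym2 C.V)).2) = (e' : Sym2 C.V)
            from Quot.out_eq _]
        simp only [Subtype.ext_iff, eq_comm]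
      simp only [this, mul_ite, mul_one, mul_zero, Finset.sum_ite_eq', Finset.mem_univ, if_true]
      rfl

/-- Only the coefficient of the edge `ab` matters, and it is 1 because this edge separates 13|24. -/
theorem sepForm_eq_one {C : MarkedGraph (Fin n)} (hn : 4 ≤ n) {a b : C.V}
    (hab : C.graph.Adj a b)
    (hsep : C.Separates ⟨s(a, b), hab⟩ (first4 hn 0) (first4 hn 2) (first4 hn 1) (first4 hn 3))
    (y : C.deformations) (hy : C.edgeLength a b y = 1)
    (hy' : ∀ s t, C.graph.Adj s t → s(s, t) ≠ s(a, b) → C.edgeLength s t y = 0) :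
    C.sepForm hn y = 1 := by
  rw [sepForm, LinearMap.sum_apply, Finset.sum_eq_single ⟨s(a, b), hab⟩]
  · rw [if_pos (Or.inr (Or.inl hsep)), one_smul]
    have : s((Quot.out s(a, b)).1, (Quot.out s(a, b)).2) = s(a, b) := Quot.out_eq _
    rcases Sym2.eq_iff.mp this with ⟨h, h'⟩ | ⟨h, h'⟩
    · simp only [h, h', hy]
    · simp only [h, h']
      exact (y.2.1 b a).trans hy
  · intro e _ he
    rw [LinearMap.smul_apply, hy' _ _ (out_adj e), smul_zero]
    rw [show s((Quot.out (e : Sym2 C.V)).1, (Quot.out (e : Sym2 C.V)).2) = (e : Sym2 C.V)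
      from Quot.out_eq _]
    exact fun h => he (Subtype.ext h)
  · simp

end PiTilde

end MarkedGraph

/-- Rearrangement of the rows of the matrix of `π̃`, if the markings are distributed to two parts. -/
def rowEquiv {A B T : Type} (τ : A ⊕ B ≃ T) :
    (((A × Fin 2 ⊕ B × Fin 2) ⊕ (Unit ⊕ Unit)) ⊕ Fin 2) ⊕ Unit ≃
      Fin 2 ⊕ (Fin 2 ⊕ (T × Fin 2) ⊕ Unit) :=
  Equiv.ofBijective
    (fun
      | .inl (.inl (.inl (.inl (i, k)))) => .inr (.inr (.inl (τ (.inl i), k)))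
      | .inl (.inl (.inl (.inr (i, k)))) => .inr (.inr (.inl (τ (.inr i), k)))
      | .inl (.inl (.inr (.inl _))) => .inr (.inl 0)
      | .inl (.inl (.inr (.inr _))) => .inr (.inl 1)
      | .inl (.inr k) => .inl k
      | .inr _ => .inr (.inr (.inr ()))) (by
    constructor
    · rintro (((((⟨i, k⟩ | ⟨i, k⟩)) | (_ | _)) | k) | _) (((((⟨j, m⟩ | ⟨j, m⟩)) | (_ | _)) | m) | _) h <;>
        simp_all
    · rintro (k | k | ⟨t, k⟩ | _)
      · exact ⟨.inl (.inr k), rfl⟩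
      · fin_cases k
        · exact ⟨.inl (.inl (.inr (.inl ()))), rfl⟩
        · exact ⟨.inl (.inl (.inr (.inr ()))), rfl⟩
      · obtain ⟨i | i, rfl⟩ := τ.surjective t
        · exact ⟨.inl (.inl (.inl (.inl (i, k)))), rfl⟩
        · exact ⟨.inl (.inl (.inl (.inr (i, k)))), rfl⟩
      · exact ⟨.inr (), rfl⟩)

namespace MarkedGraph

theorem card_ends_of_hasDegree {ι : Type} {C : MarkedGraph ι} {d : ℕ} (h : C.HasDegree d) :
    Fintype.card C.ends = 3 * d := by
  have := congrArg Multiset.card h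
  simpa [mul_comm] using this

theorem isTrivalent_of_valence {ι : Type} {C : MarkedGraph ι}
    (hC : C.IsPlaneTropicalCurve) (h : ∀ v, C.valence v = 3) : C.IsTrivalent where
  isTree := hC.isTree
  dir_symm := hC.dir_symm
  valence_eq := h
  balanced := hC.balanced

/-! ### Distribution of the markings to the two parts -/

section Splitting

variable {n l : ℕ} {C : MarkedGraph (Fin n)} {hn : 4 ≤ n} {a b : C.V} {d₁ d₂ : ℕ}

theorem SplitsAt.card_left (hT : C.graph.IsTree) (hE : C.SplitsAt hn a b d₁ d₂) :
    Fintype.card {i // C.OnSide a b (C.mark i)} = 3 * d₁ := by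
  have h₂ : ¬ C.OnSide a b (C.mark (first4 hn 1)) := fun h =>
    onSide_symm_disjoint hT hE.adj h hE.x2
  have h₄ : ¬ C.OnSide a b (C.mark (first4 hn 3)) := fun h =>
    onSide_symm_disjoint hT hE.adj h hE.x4
  have h := hE.others
  rw [Nat.card_eq_fintype_card, Fintype.card_subtype] at h
  rw [Fintype.card_subtype]
  have hs : (Finset.univ.filter fun i => C.OnSide a b (C.mark i))
      = insert (first4 hn 0) (insert (first4 hn 2)
        (Finset.univ.filter fun i : Fin n => 4 ≤ i.val ∧ C.OnSide a b (C.mark i))) := by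
    ext i
    simp only [Finset.mem_filter, Finset.mem_univ, true_and, Finset.mem_insert]
    constructor
    · intro hi
      by_cases h0 : i = first4 hn 0
      · exact Or.inl h0
      by_cases h2 : i = first4 hn 2
      · exact Or.inr (Or.inl h2)
      have h1 : i ≠ first4 hn 1 := by
        rintro rfl
        exact h₂ hi
      have h3 : i ≠ first4 hn 3 := by
        rintro rfl
        exact h₄ hi
      refine Or.inr (Or.inr ⟨?_, hi⟩)
      simp only [first4, ne_eq, Fin.ext_iff, Fin.val_castLE] at h0 h1 h2 h3
      simp at h0 h1 h2 h3
      omega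
    · rintro (rfl | rfl | hi)
      · exact hE.x1
      · exact hE.x3
      · exact hi.2
  -- Positivity is needed because `3 * d₁ - 2` is a truncated subtraction.
  have hpos := hE.left_pos
  rw [hs, Finset.card_insert_of_notMem, Finset.card_insert_of_notMem, h]
  · omega
  · simp [first4]
  · simp [first4, Fin.ext_iff]

theorem SplitsAt.card_right (hT : C.graph.IsTree) (hE : C.SplitsAt hn a b d₁ d₂)
    (hd : n = 3 * (d₁ + d₂)) : Fintype.card {i // C.OnSide b a (C.mark i)} = 3 * d₂ := by
  have h₁ := hE.card_left hT
  have h₂ : Fintype.card {i // C.OnSide b a (C.mark i)}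
      = Fintype.card {i // ¬ C.OnSide a b (C.mark i)} :=
    Fintype.card_congr (Equiv.subtypeEquivRight fun i => onSide_comm_iff_not hT hE.adj _)
  rw [Fintype.card_subtype_compl, Fintype.card_fin] at h₂
  omega

/-- The markings other than the first two are distributed to the two parts. -/
def splitEquiv (hT : C.graph.IsTree) (hE : C.SplitsAt hn a b d₁ d₂) :
    C.SideMarkings a b (first4 hn 0) hE.x1 ⊕ C.SideMarkings b a (first4 hn 1) hE.x2 ≃
      {i : Fin n // 2 ≤ i.val} :=
  have h2 : ∀ i : Fin n, i ≠ first4 hn 0 → i ≠ first4 hn 1 → 2 ≤ i.val := by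
    intro i h0 h1
    simp only [first4, ne_eq, Fin.ext_iff, Fin.val_castLE] at h0 h1
    simp at h0 h1
    omega
  ((C.sideMarkingsEquiv a b _ _).sumCongr (C.sideMarkingsEquiv b a _ _)).trans
  { toFun := Sum.elim
      (fun i => ⟨i.1, h2 i.1 i.2.2 fun h => onSide_symm_disjoint hT hE.adj i.2.1 (h ▸ hE.x2)⟩)
      (fun i => ⟨i.1, h2 i.1 (fun h => onSide_symm_disjoint hT hE.adj (h ▸ hE.x1) i.2.1) i.2.2⟩)
    invFun := fun i => if h : C.OnSide a b (C.mark i) then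
        .inl ⟨i.1, h, fun h' => by have := i.2; simp [h', first4] at this⟩
      else .inr ⟨i.1, (onSide_or hT hE.adj _).resolve_left h,
        fun h' => by have := i.2; simp [h', first4] at this⟩
    left_inv := by
      rintro (i | i)
      · simp [i.2.1]
      · have := (onSide_comm_iff_not hT hE.adj _).mp i.2.1
        simp [this]
    right_inv := by
      intro i
      by_cases h : C.OnSide a b (C.mark i) <;> simp [h] }

theorem splitEquiv_inl (hT : C.graph.IsTree) (hE : C.SplitsAt hn a b d₁ d₂)
    (j : C.SideMarkings a b (first4 hn 0) hE.x1) :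
    ((C.side a b).mark j.1.1).1 = C.mark (splitEquiv hT hE (.inl j)).1 := by
  obtain ⟨⟨_ | i, h⟩, h'⟩ := j
  · exact absurd rfl h
  · rfl

theorem splitEquiv_inr (hT : C.graph.IsTree) (hE : C.SplitsAt hn a b d₁ d₂)
    (j : C.SideMarkings b a (first4 hn 1) hE.x2) :
    ((C.side b a).mark j.1.1).1 = C.mark (splitEquiv hT hE (.inr j)).1 := by
  obtain ⟨⟨_ | i, h⟩, h'⟩ := j
  · exact absurd rfl h
  · rfl

end Splitting

end MarkedGraph

/-! ### Factoring the determinant of `π̃` -/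

namespace MarkedGraph

variable {n l : ℕ} {C : MarkedGraph (Fin n)} {hn : 4 ≤ n} {a b : C.V} {d₁ d₂ : ℕ}

theorem sideEvMult_eq (hC : C.IsTrivalent) (hab : C.graph.Adj a b) (h₀ : C.dir a b = 0) {x : Fin n}
    (hx : C.OnSide a b (C.mark x)) (hV : 2 < Fintype.card (C.side a b).V) :
    C.sideEvMult a b x hx = absDetOn fun i : C.SideMarkings a b x hx × Fin 2 =>
      (C.forgetSide a b x hx).position ((C.forgetSide a b x hx).mark i.1) i.2 := by
  have h := forgetSide_isTrivalent hC hab h₀ hx hV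
  exact evMult_eq _ h.isTree h.dir_symm

/-- The linear forms on the deformations of the two parts that correspond to the rows of the matrix
of `π̃` (except for the row of the length coordinate) and to the condition that the parts fit together. -/
def cutForm (C : MarkedGraph (Fin n)) (a b : C.V) (x y : Fin n) (hx : C.OnSide a b (C.mark x))
    (hy : C.OnSide b a (C.mark y)) (u v : Fin 2 → ℤ) :
    ((C.SideMarkings a b x hx × Fin 2 ⊕ C.SideMarkings b a y hy × Fin 2) ⊕ (Unit ⊕ Unit)) ⊕ Fin 2 →
      (C.side a b).deformations × (C.side b a).deformations →ₗ[ℤ] ℤ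
  | .inl (.inl (.inl i)) =>
      ((C.side a b).position ((C.side a b).mark i.1.1.1) i.2).comp (LinearMap.fst ℤ _ _)
  | .inl (.inl (.inr i)) =>
      ((C.side b a).position ((C.side b a).mark i.1.1.1) i.2).comp (LinearMap.snd ℤ _ _)
  | .inl (.inr (.inl _)) =>
      ((C.side a b).crossPosition u ((C.side a b).mark (some ⟨x, hx⟩))).comp (LinearMap.fst ℤ _ _)
  | .inl (.inr (.inr _)) =>
      ((C.side b a).crossPosition v ((C.side b a).mark (some ⟨y, hy⟩))).comp (LinearMap.snd ℤ _ _)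
  | .inr k => ((C.side b a).position ((C.side b a).mark none) k).comp (LinearMap.snd ℤ _ _) -
      ((C.side a b).position ((C.side a b).mark none) k).comp (LinearMap.fst ℤ _ _)

/-- In the coordinates of `exists_forgetSide_equiv` on both parts this is the block shape of
`absDetOn_glue`. -/
theorem absDetOn_cutForm (hC : C.IsTrivalent) (hab : C.graph.Adj a b) (h₀ : C.dir a b = 0)
    {x y₀ : Fin n} (hx : C.OnSide a b (C.mark x)) (hy : C.OnSide b a (C.mark y₀)) (u v : Fin 2 → ℤ)
    (hVa : 2 < Fintype.card (C.side a b).V) (hVb : 2 < Fintype.card (C.side b a).V)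
    (hcarda : Fintype.card (C.side a b).ends = Fintype.card {i // C.OnSide a b (C.mark i)})
    (hcardb : Fintype.card (C.side b a).ends = Fintype.card {i // C.OnSide b a (C.mark i)}) :
    absDetOn (C.cutForm a b x y₀ hx hy u v) =
      C.sideEvMult a b x hx * C.sideEvMult b a y₀ hy *
        interMult (C.side a b) none (C.side b a) none *
        (cross u ((C.side a b).edgeDir (some ⟨x, hx⟩))).natAbs *
        (cross v ((C.side b a).edgeDir (some ⟨y₀, hy⟩))).natAbs := by
  have h₀' : C.dir b a = 0 := by rw [hC.dir_symm _ _ hab, h₀, neg_zero]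
  obtain ⟨e, α, β, w, z, hw, hz, hmark, hα, hβ⟩ := exists_forgetSide_equiv hC hab h₀ hx hVa
  obtain ⟨e', α', β', w', z', hw', hz', hmark', hα', hβ'⟩ :=
    exists_forgetSide_equiv hC hab.symm h₀' hy hVb
  have hx' : ∀ y, C.cutForm a b x y₀ hx hy u v (.inl (.inr (.inl ()))) y
      = (u 0 • α 1 - u 1 • α 0) (e y.1).1.1 + (e y.1).1.2 * cross u z := by
    intro y
    refine (congrArg₂ (fun s t => u 0 * s - u 1 * t) (hα 1 y.1) (hα 0 y.1)).trans ?_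
    simp only [LinearMap.sub_apply, LinearMap.smul_apply, smul_eq_mul, cross]
    ring
  have hy' : ∀ y, C.cutForm a b x y₀ hx hy u v (.inl (.inr (.inr ()))) y
      = (v 0 • α' 1 - v 1 • α' 0) (e' y.2).1.1 + (e' y.2).1.2 * cross v z' := by
    intro y
    refine (congrArg₂ (fun s t => v 0 * s - v 1 * t) (hα' 1 y.2) (hα' 0 y.2)).trans ?_
    simp only [LinearMap.sub_apply, LinearMap.smul_apply, smul_eq_mul, cross]
    ring
  have key := absDetOn_glue e e'
    (fun i : C.SideMarkings a b x hx × Fin 2 =>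
      (C.forgetSide a b x hx).position ((C.forgetSide a b x hx).mark i.1) i.2)
    (fun i : C.SideMarkings b a y₀ hy × Fin 2 =>
      (C.forgetSide b a y₀ hy).position ((C.forgetSide b a y₀ hy).mark i.1) i.2)
    (Nat.card_eq_fintype_card.symm.trans (card_sideMarkings hC hab h₀ hx hVa hcarda))
    (Nat.card_eq_fintype_card.symm.trans (card_sideMarkings hC hab.symm h₀' hy hVb hcardb))
    _ _ _ _ β β' w w' (C.cutForm a b x y₀ hx hy u v)
    (fun i y => hmark i.1 i.2 y.1) (fun i y => hmark' i.1 i.2 y.2) hx' hy'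
    (fun k y => congrArg₂ (fun s t : ℤ => s - t) (hβ' k y.2) (hβ k y.1))
  rw [key, sideEvMult_eq hC hab h₀ hx hVa, sideEvMult_eq hC hab.symm h₀' hy hVb, interMult,
    natAbs_cross_of_eq_or_eq_neg hw hw']
  -- If the directions at `P` and `Q` are dependent, both sides vanish. Otherwise they are nonzero,
  -- which excludes the case where `x` or `y₀` shares a vertex with the new marking.
  by_cases hww : (cross w w').natAbs = 0
  · simp only [hww, mul_zero, zero_mul]
  · have hne : ∀ u' v' : Fin 2 → ℤ, (u' = w ∨ u' = -w) → (v' = w' ∨ v' = -w') → u' ≠ 0 ∧ v' ≠ 0 := by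
      intro u' v' hu' hv'
      rw [← natAbs_cross_of_eq_or_eq_neg hu' hv'] at hww
      constructor <;> rintro rfl <;> simp [cross] at hww
    rw [natAbs_cross_of_eq_or_eq_neg (Or.inl rfl) (hz.resolve_left (hne _ _ hw hw').1),
      natAbs_cross_of_eq_or_eq_neg (Or.inl rfl) (hz'.resolve_left (hne _ _ hw hw').2)]

theorem finrank_side (hC : C.IsTrivalent) (hab : C.graph.Adj a b) (h₀ : C.dir a b = 0) {x : Fin n}
    (hx : C.OnSide a b (C.mark x)) (hV : 2 < Fintype.card (C.side a b).V)
    (hcard : Fintype.card (C.side a b).ends = Fintype.card {i // C.OnSide a b (C.mark i)}) :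
    Module.finrank ℤ (C.side a b).deformations
      = Nat.card (C.SideMarkings a b x hx × Fin 2) + 2 := by
  obtain ⟨e, -⟩ := exists_forgetSide_equiv hC hab h₀ hx hV
  rw [LinearEquiv.finrank_eq e, card_sideMarkings hC hab h₀ hx hV hcard]
  simp

/-- The length coordinate on deformations of the two parts and a length of the contracted edge. -/
def cutSepForm (hC : C.IsTrivalent) (hab : C.graph.Adj a b) (h₀ : C.dir a b = 0) (hn : 4 ≤ n) :
    ((C.side a b).deformations × (C.side b a).deformations) × ℤ →ₗ[ℤ] ℤ :=
  ((C.sepForm hn).comp (LinearMap.snd ℤ (Fin 2 → ℤ) _)).comp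
    (cutEquiv hC.isTree hC.dir_symm hab h₀).symm.toLinearMap

/-- The vector `(0, 1)` comes from the deformation that lengthens the contracted edge and leaves all
other lengths at 0. -/
theorem natAbs_cutSepForm (hC : C.IsTrivalent) (hE : C.SplitsAt hn a b d₁ d₂) :
    (cutSepForm hC hE.adj hE.contracted hn (0, 1)).natAbs = 1 := by
  have hT := hC.isTree
  set E := cutEquiv hC.isTree hC.dir_symm hE.adj hE.contracted
  have hz : E (E.symm (0, 1)) = (0, 1) := E.apply_symm_apply _
  obtain ⟨hz', hz₃⟩ := Prod.ext_iff.mp hz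
  obtain ⟨hz₁, hz₂⟩ := Prod.ext_iff.mp hz'
  have : C.sepForm hn (E.symm (0, 1)).2 = 1 := by
    refine sepForm_eq_one hn hE.adj
      ⟨a, b, rfl, hE.x1, hE.x3, hE.x2, hE.x4⟩ _ hz₃ fun s t hst hne => ?_
    rcases onSide_or hT hE.adj s with hs | hs
    · have ht := (C.onSide_iff_of_adj a b hst hne).mp hs
      exact congrFun (congrFun (congrArg (fun y => y.1.2) hz₁) ⟨s, hs⟩) ⟨t, ht⟩
    · have ht := (C.onSide_iff_of_adj b a hst (by rwa [Sym2.eq_swap (a := b)])).mp hs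
      exact (add_zero _).symm.trans
        (congrFun (congrFun (congrArg (fun y => y.1.2) hz₂) ⟨s, hs⟩) ⟨t, ht⟩)
  change (C.sepForm hn (E.symm (0, 1)).2).natAbs = 1
  rw [this]
  rfl

/-- The rows of the matrix of `π̃`, extended to linear forms on pairs of a translation of the part on the
side of `b` and a deformation. -/
def translatedPiForm (C : MarkedGraph (Fin n)) (hn : 4 ≤ n) (L : TropicalCurve l) (a b : C.V) :
    Fin 2 ⊕ ({i : Fin n // 2 ≤ i.val} × Fin 2) ⊕ Unit → (Fin 2 → ℤ) × C.deformations →ₗ[ℤ] ℤ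
  | .inl k => (C.crossPosition (L.edgeVector (C.ev (first4 hn (Fin.castLE (by norm_num) k))))
      (C.mark (first4 hn (Fin.castLE (by norm_num) k)))).comp
      (if k = 0 then LinearMap.snd ℤ _ _ else
        LinearMap.snd ℤ _ _ + C.translation.comp (LinearMap.fst ℤ _ _))
  | .inr (.inl i) => (C.position (C.mark i.1) i.2).comp
      (if C.OnSide a b (C.mark i.1) then LinearMap.snd ℤ _ _ else
        LinearMap.snd ℤ _ _ + C.translation.comp (LinearMap.fst ℤ _ _))
  | .inr (.inr _) => (C.sepForm hn).comp (LinearMap.snd ℤ _ _)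

theorem translatedPiForm_comp_inr (L : TropicalCurve l) (i) :
    (C.translatedPiForm hn L a b i).comp (LinearMap.inr ℤ _ _) = C.piForm hn L i := by
  ext y
  rcases i with k | i | i
  · simp only [translatedPiForm, piForm]
    split_ifs <;> simp
  · simp only [translatedPiForm, piForm]
    split_ifs <;> simp
  · rfl

/-- The determinant of one family on `ℤ² × Def(C) ≅ Def(C₁) × Def(C₂) × ℤ` is computed on both
sides: splitting off the translation leaves the rows of `π̃`, splitting off the length of the
contracted edge leaves `cutForm`. -/
theorem absDetOn_piForm (hC : C.IsTrivalent) (hE : C.SplitsAt hn a b d₁ d₂) (L : TropicalCurve l)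
    (hVa : 2 < Fintype.card (C.side a b).V) (hVb : 2 < Fintype.card (C.side b a).V)
    (hcarda : Fintype.card (C.side a b).ends = Fintype.card {i // C.OnSide a b (C.mark i)})
    (hcardb : Fintype.card (C.side b a).ends = Fintype.card {i // C.OnSide b a (C.mark i)}) :
    absDetOn (C.piForm hn L) = absDetOn (C.cutForm a b (first4 hn 0) (first4 hn 1) hE.x1 hE.x2
      (L.edgeVector (C.ev (first4 hn 0))) (L.edgeVector (C.ev (first4 hn 1)))) := by
  have hT := hC.isTree
  have hab := hE.adj
  have h₀ := hE.contracted
  have h₀' : C.dir b a = 0 := by rw [hC.dir_symm _ _ hab, h₀, neg_zero]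
  -- The translation coordinates contribute a block of determinant 1, so how the rows of `π̃` extend
  -- to translations is irrelevant. The extension in `translatedPiForm` lets the markings on the
  -- side of `b` move along.
  have h₁ := absDetOn_prod (fun k : Fin 2 => (LinearMap.proj k : (Fin 2 → ℤ) →ₗ[ℤ] ℤ))
    (C.translatedPiForm hn L a b) (by simp)
  simp only [translatedPiForm_comp_inr, absDetOn_proj, one_mul] at h₁
  have hrank : Fintype.card (((C.SideMarkings a b (first4 hn 0) hE.x1 × Fin 2 ⊕
      C.SideMarkings b a (first4 hn 1) hE.x2 × Fin 2) ⊕ (Unit ⊕ Unit)) ⊕ Fin 2)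
      = Module.finrank ℤ ((C.side a b).deformations × (C.side b a).deformations) := by
    rw [Module.finrank_prod, finrank_side hC hab h₀ hE.x1 hVa hcarda,
      finrank_side hC hab.symm h₀' hE.x2 hVb hcardb]
    simp only [Fintype.card_sum, Fintype.card_unit, Fintype.card_fin, Nat.card_eq_fintype_card]
    omega
  have h₂ := absDetOn_prod (C.cutForm a b (first4 hn 0) (first4 hn 1) hE.x1 hE.x2
      (L.edgeVector (C.ev (first4 hn 0))) (L.edgeVector (C.ev (first4 hn 1))))
    (fun _ : Unit => cutSepForm hC hab h₀ hn) hrank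
  rw [absDetOn_unit] at h₂
  have h₃ := natAbs_cutSepForm hC hE
  rw [LinearMap.comp_apply, LinearMap.inr_apply, h₃, mul_one] at h₂
  rw [← h₁, ← h₂, ← absDetOn_reindex _ (rowEquiv (splitEquiv hT hE))]
  refine absDetOn_congr_equiv _ _ (cutEquiv hT hC.dir_symm hab h₀) ?_
  rintro (((((⟨j, k⟩ | ⟨j, k⟩)) | (_ | _)) | k) | _) ⟨z, y⟩
  · have hj := splitEquiv_inl hT hE j
    have hside : C.OnSide a b (C.mark (splitEquiv hT hE (.inl j)).1) := hj ▸ ((C.side a b).mark j.1.1).2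
    change C.position _ k ((if _ then _ else _ : _ →ₗ[ℤ] _) (z, y)) = y.1.1 ((C.side a b).mark j.1.1).1 k
    rw [if_pos hside, hj]
    rfl
  · have hj := splitEquiv_inr hT hE j
    have hside : C.OnSide b a (C.mark (splitEquiv hT hE (.inr j)).1) := hj ▸ ((C.side b a).mark j.1.1).2
    change C.position _ k ((if _ then _ else _ : _ →ₗ[ℤ] _) (z, y))
      = y.1.1 ((C.side b a).mark j.1.1).1 k + z k
    rw [if_neg ((onSide_comm_iff_not hT hab _).mp hside), hj]
    rfl
  · rfl
  · rfl
  -- The translation coordinate equals the gluing form, since `a` and `b` have the same image.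
  · change z k = (y.1.1 b k + z k) - y.1.1 a k
    have := y.2.2.2 a b hab k
    rw [this, h₀]
    simp
  · change C.sepForm hn y = C.sepForm hn ((cutEquiv hT hC.dir_symm hab h₀).symm
      (cutEquiv hT hC.dir_symm hab h₀ (z, y))).2
    rw [LinearEquiv.symm_apply_apply]

end MarkedGraph

end

end TropicalTangency

open TropicalTangency.MarkedGraph in
theorem mainTheorem5 (d l : ℕ) (hn : 4 ≤ 3 * d) (L : TropicalCurve l)
    (q : {i : Fin (3 * d) // 2 ≤ i.val} → Fin 2 → ℝ) (len : ℝ) (hlen : 0 < len)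
    (hQ : InGeneralPosition hn d L (q, M4.typeB len hlen))
    (C : MarkedGraph (Fin (3 * d))) (hC : C.InDomain hn d L)
    (hCQ : C.piTilde hn = (q, M4.typeB len hlen))
    (d₁ d₂ : ℕ) (hdd : d₁ + d₂ = d) (a b : C.V) (hE : C.SplitsAt hn a b d₁ d₂) :
    C.piMult hn L =
      C.sideEvMult a b (first4 hn 0) hE.x1 *
      C.sideEvMult b a (first4 hn 1) hE.x2 *
      MarkedGraph.interMult (C.side a b) none (C.side b a) none *
      (C.side a b).interMultAt L (some ⟨first4 hn 0, hE.x1⟩) *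
      (C.side b a).interMultAt L (some ⟨first4 hn 1, hE.x2⟩) := by
  -- General position enters here: it makes `C` 3-valent.
  have hT : C.IsTrivalent := isTrivalent_of_valence hC.isCurve (hQ.2 C hC hCQ).1
  have h₀' : C.dir b a = 0 := by rw [hT.dir_symm _ _ hE.adj, hE.contracted, neg_zero]
  have hNa := hE.card_left hT.isTree
  have hNb := hE.card_right hT.isTree (by rw [hdd])
  have hcarda := (card_ends_of_hasDegree hE.degree_left).trans hNa.symm
  have hcardb := (card_ends_of_hasDegree hE.degree_right).trans hNb.symm
  have hVa := card_side_V hT hE.adj hE.contracted hcarda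
  have hVb := card_side_V hT hE.adj.symm h₀' hcardb
  have h₁ := hE.left_pos
  have h₂ := hE.right_pos
  -- Each part has `6 dᵢ - 1 ≥ 5` vertices, so two markings can be forgotten without reaching a
  -- one-vertex tree too early.
  rw [piMult_eq C hn L hT.isTree hT.dir_symm,
    absDetOn_piForm hT hE L (by omega) (by omega) hcarda hcardb,
    absDetOn_cutForm hT hE.adj hE.contracted hE.x1 hE.x2 _ _ (by omega) (by omega) hcarda hcardb]
  rfl
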